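/- **Setting.** Let $N$ be a lattice of rank $n$, $N_{\mathbb R}=N\otimes\mathbb R$, $M=\mathrm{Hom}(N,\mathbb Z)$, $T=N\otimes\mathbb C^\times$ the torus, and $\Sigma$ a complete fan in $N_{\mathbb R}$: a finite collection of strictly convex rational polyhedral cones, closed under faces, any two of which meet in a common face, and whose union is $N_{\mathbb R}$. Let $\Sigma(n)$ be the set of its $n$-dimensional cones. Let $X_\Sigma$ be the toric variety over $\mathbb C$ glued from $U(\sigma)=\mathrm{Spec}\,\mathbb C[\sigma^\vee\cap M]$, $\sigma\in\Sigma$, where $t\in T$ acts on functions by $t\cdot z^m=t^mz^m$ with $(t\cdot f)(x)=f(t^{-1}x)$. A *cone complex* is a space $X$ with a finite collection of closed subsets (cones) $\sigma$, each with a finitely generated group $M(\sigma)$ of continuous real functions on $\sigma$, such that $x\mapsto(u\mapsto u(x))$ maps $\sigma$ homeomorphically onto a rational polyhedral cone in $(M(\sigma)\otimes\mathbb R)^\vee$; the preimage $\tau$ of each face of that cone is again a cone of the complex, with $M(\tau)=M(\sigma)|_\tau$; and $X$ is the disjoint union of the relative interiors of its cones. A *morphism* $f$ is a continuous map such that for every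 cone $\sigma'$ of the source there is a cone $\sigma$ of the target with $f(\sigma')\subseteq\sigma$ and $f^*M(\sigma)\subseteq M(\sigma')$. The pair $(N_{\mathbb R},\Sigma)$ is a cone complex with $M(\sigma)=M|_\sigma$. A *weight* is a function $\mu:X\to\mathbb Z_{>0}$ that is constant, with value $\mu(\sigma)$, on the relative interior of each cone $\sigma$; for $f:X\to Y$ put $Tr_f(\mu)(y)=\sum_{x\in f^{-1}(y)}\mu(x)$. A *tropical Lagrangian multi-section of rank $r$ over $\Sigma$* is a tuple $\mathbb L=(L,\Sigma_L,\mu,\pi,\varphi)$: a cone complex $(L,\Sigma_L)$ with weight $\mu$; a surjective morphism $\pi:L\to N_{\mathbb R}$ that maps every $\sigma'\in\Sigma_L$ isomorphically (homeomorphically, with $M(\sigma')=\pi^*M(\pi(\sigma'))$) onto a cone of $\Sigma$, such that $Tr_\pi(\mu)\equiv r$ and, for every connected open $U\subseteq N_{\mathbb R}$ and every connected component $W$ of $\pi^{-1}(U)$, $Tr_{\pi|_W}(\mu)$ is constant on $U$; and a function $\varphi:L\to\mathbb R$ with $\varphi|_{\sigma'}\in M(\sigma')$ for all $\sigma'\in\Sigma_L$.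 It is *connected* if $L$ is. Write $\mathbb L\le\mathbb L'$ (equal rank) if there is a surjective morphism $f:L'\to L$ with $\pi\circ f=\pi'$, $Tr_f(\mu')=\mu$ and $\varphi\circ f=\varphi'$. For connected $\mathbb L,\mathbb L'$ of the same rank write $\mathbb L\sim_c\mathbb L'$ if some multi-section $\mathbb L''$ over $\Sigma$ has $\mathbb L''\le\mathbb L$ and $\mathbb L''\le\mathbb L'$; *combinatorial equivalence* means being joined by a finite sequence of steps $\sim_c$. For $\sigma\in\Sigma(n)$ let $\sigma^{(1)},\dots,\sigma^{(r)}$ be the cones of $\Sigma_L$ over $\sigma$, each listed $\mu$ times, and $m(\sigma^{(\alpha)})\in M$ the slope of $\varphi$ on $\sigma^{(\alpha)}$. A *Kaneyama datum* of $\mathbb L$ is a family $\mathbf g=(g_{\sigma_1\sigma_2})_{\sigma_1,\sigma_2\in\Sigma(n)}$ in $GL(r,\mathbb C)$, the rows of $g_{\sigma_1\sigma_2}$ indexed by the lifts of $\sigma_1$ and the columns by those of $\sigma_2$, with $g_{\sigma\sigma}=\mathrm{Id}$, $g_{\sigma_1\sigma_2}g_{\sigma_2\sigma_3}=g_{\sigma_1\sigma_3}$,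 and $(\alpha,\beta)$-entry nonzero only if $\sigma_1^{(\alpha)}\cap\sigma_2^{(\beta)}\ne\emptyset$ and $m(\sigma_1^{(\alpha)})-m(\sigma_2^{(\beta)})\in(\sigma_1\cap\sigma_2)^\vee$. Two data $\mathbf g,\mathbf g'$ are *equivalent* if there are $h_\sigma\in GL(r,\mathbb C)$, $\sigma\in\Sigma(n)$, whose $(\alpha,\beta)$-entry is nonzero only if $m(\sigma^{(\alpha)})-m(\sigma^{(\beta)})\in\sigma^\vee$, with $h_{\sigma_1}g_{\sigma_1\sigma_2}=g'_{\sigma_1\sigma_2}h_{\sigma_2}$ for all $\sigma_1,\sigma_2\in\Sigma(n)$. Let $\mathcal K(\mathbb L)$ be the set of equivalence classes (possibly empty). The toric vector bundle $\mathcal E(\mathbb L,\mathbf g)$ on $X_\Sigma$ is glued from the trivial bundles over $U(\sigma)$, $\sigma\in\Sigma(n)$, with frames $1(\sigma^{(\alpha)})$, by $1(\sigma_1^{(\alpha)})=\sum_\beta g_{\sigma_1^{(\alpha)}\sigma_2^{(\beta)}}\,z^{m(\sigma_1^{(\alpha)})-m(\sigma_2^{(\beta)})}\,1(\sigma_2^{(\beta)})$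 over $U(\sigma_1\cap\sigma_2)$, with torus action $t\cdot(x,1(\sigma^{(\alpha)}))=(t\cdot x,\,t^{m(\sigma^{(\alpha)})}1(\sigma^{(\alpha)}))$. Toric vector bundles are isomorphic if there is a $T$-equivariant isomorphism of algebraic vector bundles covering the identity of $X_\Sigma$. **Theorem.** Let $\mathbb L_1,\mathbb L_2$ be connected tropical Lagrangian multi-sections over $\Sigma$ of the same rank $r$. 1. If $\mathbb L_1$ and $\mathbb L_2$ are combinatorially equivalent, then there is a bijection $f_*:\mathcal K(\mathbb L_1)\to\mathcal K(\mathbb L_2)$ such that $\mathcal E(\mathbb L_1,\mathbf g_1)\cong\mathcal E(\mathbb L_2,\mathbf g_2)$ as toric vector bundles whenever $f_*[\mathbf g_1]=[\mathbf g_2]$. 2. Conversely, if $\mathcal E(\mathbb L_1,\mathbf g_1)\cong\mathcal E(\mathbb L_2,\mathbf g_2)$ as toric vector bundles for some Kaneyama data $\mathbf g_1$ of $\mathbb L_1$ and $\mathbf g_2$ of $\mathbb L_2$, then $\mathbb L_1$ is combinatorially equivalent to $\mathbb L_2$. -/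

import Mathlib

open Module

universe u v w

namespace TropToric

/-! ## Lattices, fans, and affine toric charts -/

section Fans

variable {V : Type v} [NormedAddCommGroup V] [NormedSpace ℝ V]

/-- The dual lattice `M` of a lattice `N` in the real vector space `V`, as a group of linear
functionals: those taking integral values on `N`. -/
def dualLattice (N : Submodule ℤ V) : AddSubgroup (Dual ℝ V) where
  carrier := {m | ∀ x ∈ N, ∃ k : ℤ, m x = k}
  zero_mem' := fun x _ => ⟨0, by simp⟩
  add_mem' := by
    intro a b ha hb x hx
    obtain ⟨k, hk⟩ := ha x hx
    obtain ⟨l, hl⟩ := hb x hx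
    exact ⟨k + l, by simp [hk, hl]⟩
  neg_mem' := by
    intro a ha x hx
    obtain ⟨k, hk⟩ := ha x hx
    exact ⟨-k, by simp [hk]⟩

/-- A rational polyhedral cone: the cone generated by finitely many lattice vectors. -/
def IsRationalPolyhedral (N : Submodule ℤ V) (σ : PointedCone ℝ V) : Prop :=
  ∃ S : Finset V, (S : Set V) ⊆ N ∧ σ = PointedCone.hull ℝ (S : Set V)

/-- `τ` is a face of `σ`: `τ = σ ∩ m^⊥` for some `m` in `M` that is nonnegative on `σ`.
(For a rational cone, real functionals cut out the same faces.) -/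
def IsFace (N : Submodule ℤ V) (τ σ : PointedCone ℝ V) : Prop :=
  ∃ m : dualLattice N, (∀ x ∈ σ, 0 ≤ m.1 x) ∧ ∀ x, x ∈ τ ↔ x ∈ σ ∧ m.1 x = 0

/-- A complete fan of strictly convex rational polyhedral cones. -/
structure CompleteFan (N : Submodule ℤ V) where
  cones : Set (PointedCone ℝ V)
  finite : cones.Finite
  rational : ∀ σ ∈ cones, IsRationalPolyhedral N σ
  strictlyConvex : ∀ σ ∈ cones, ∀ x ∈ σ, -x ∈ σ → x = 0
  face_mem : ∀ σ ∈ cones, ∀ τ, IsFace N τ σ → τ ∈ cones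
  inter_face : ∀ σ ∈ cones, ∀ τ ∈ cones, IsFace N (σ ⊓ τ) σ
  complete : ∀ x : V, ∃ σ ∈ cones, x ∈ σ

variable {N : Submodule ℤ V}

/-- The set `Σ(n)` of cones of the fan of full dimension. -/
abbrev CompleteFan.MaxCone (F : CompleteFan N) : Type v :=
  {σ : PointedCone ℝ V // σ ∈ F.cones ∧ finrank ℝ (Submodule.span ℝ (σ : Set V)) = finrank ℝ V}

/-- The monoid `σ^∨ ∩ M`. -/
def dualMonoid (N : Submodule ℤ V) (σ : PointedCone ℝ V) : AddSubmonoid (dualLattice N) where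
  carrier := {m | ∀ x ∈ σ, 0 ≤ m.1 x}
  zero_mem' := fun x _ => by simp
  add_mem' := by
    intro a b ha hb x hx
    have h1 := ha x hx
    have h2 := hb x hx
    simpa using add_nonneg h1 h2

lemma dualMonoid_anti {τ σ : PointedCone ℝ V} (h : τ ≤ σ) : dualMonoid N σ ≤ dualMonoid N τ :=
  fun _ hm x hx => hm x (h hx)

/-- The coordinate ring `ℂ[σ^∨ ∩ M]`. -/
abbrev CoordRing (N : Submodule ℤ V) (σ : PointedCone ℝ V) : Type v :=
  AddMonoidAlgebra ℂ (dualMonoid N σ)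

/-- The (closed, i.e. complex) points of the affine toric variety `U(σ) = Spec ℂ[σ^∨ ∩ M]`.
The value at the point `x` of a regular function `f` in `ℂ[σ^∨ ∩ M]` is `x f`. -/
abbrev AffineChart (N : Submodule ℤ V) (σ : PointedCone ℝ V) : Type v :=
  CoordRing N σ →ₐ[ℂ] ℂ

/-- The inclusion `U(τ) → U(σ)` for `τ ⊆ σ`, dual to `ℂ[σ^∨ ∩ M] ⊆ ℂ[τ^∨ ∩ M]`. -/
noncomputable def chartIncl {τ σ : PointedCone ℝ V} (h : τ ≤ σ) (x : AffineChart N τ) : AffineChart N σ :=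
  x.comp (AddMonoidAlgebra.mapDomainAlgHom ℂ ℂ (AddSubmonoid.inclusion (dualMonoid_anti h)))

/-- The torus `N ⊗ ℂ^× = Hom(M, ℂ^×)`; the value `t m` is the usual `t^m`. -/
def Torus (N : Submodule ℤ V) : Type v := Multiplicative (dualLattice N) →* ℂˣ

noncomputable instance torusCommGroup : CommGroup (Torus N) :=
  inferInstanceAs (CommGroup (Multiplicative (dualLattice N) →* ℂˣ))

/-- The complex number `t^m`. -/
def Torus.pow (t : Torus N) (m : dualLattice N) : ℂ :=
  ((show Multiplicative (dualLattice N) →* ℂˣ from t) (Multiplicative.ofAdd m) : ℂ)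

lemma Torus.pow_add (t : Torus N) (m m' : dualLattice N) :
    t.pow (m + m') = t.pow m * t.pow m' := by
  unfold Torus.pow
  rw [ofAdd_add, map_mul, Units.val_mul]

lemma Torus.pow_zero (t : Torus N) : t.pow 0 = 1 := by
  unfold Torus.pow
  rw [ofAdd_zero, map_one, Units.val_one]

lemma Torus.mul_pow (s t : Torus N) (m : dualLattice N) : (s * t).pow m = s.pow m * t.pow m :=
  rfl

lemma Torus.one_pow (m : dualLattice N) : (1 : Torus N).pow m = 1 := rfl

lemma Torus.pow_ne_zero (t : Torus N) (m : dualLattice N) : t.pow m ≠ 0 := Units.ne_zero _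

lemma Torus.inv_pow (t : Torus N) (m : dualLattice N) : t⁻¹.pow m = (t.pow m)⁻¹ := by
  apply eq_inv_of_mul_eq_one_left
  rw [← Torus.mul_pow, inv_mul_cancel, Torus.one_pow]

/-- The action of the torus on regular functions: `t · z^m = t^m z^m`. -/
noncomputable def ringAct (σ : PointedCone ℝ V) (t : Torus N) : CoordRing N σ →ₐ[ℂ] CoordRing N σ :=
  AddMonoidAlgebra.lift ℂ (CoordRing N σ) (dualMonoid N σ)
    { toFun := fun m => AddMonoidAlgebra.single m.toAdd (t.pow m.toAdd.1)
      map_one' := by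
        simp [Torus.pow_zero, AddMonoidAlgebra.one_def]
      map_mul' := by
        intro a b
        simp [Torus.pow_add, AddMonoidAlgebra.single_mul_single] }

lemma ringAct_single (σ : PointedCone ℝ V) (t : Torus N) (m : dualMonoid N σ) (c : ℂ) :
    ringAct σ t (AddMonoidAlgebra.single m c) = AddMonoidAlgebra.single m (c * t.pow m.1) := by
  simp [ringAct, AddMonoidAlgebra.lift_single]

lemma chart_ext {σ : PointedCone ℝ V} {x y : AffineChart N σ}
    (h : ∀ m, x (AddMonoidAlgebra.single m 1) = y (AddMonoidAlgebra.single m 1)) : x = y :=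
  AddMonoidAlgebra.algHom_ext h (Subsingleton.elim _ _)

/-- The action of the torus on the points of `U(σ)`; the action on functions is
`(t · f)(x) = f(t⁻¹ · x)`, that is, `f(t · x) = (t⁻¹ · f)(x)`. -/
noncomputable instance chartAction (σ : PointedCone ℝ V) :
    MulAction (Torus N) (AffineChart N σ) where
  smul t x := x.comp (ringAct σ t⁻¹)
  one_smul x := by
    apply chart_ext
    intro m
    change x (ringAct σ (1 : Torus N)⁻¹ _) = _
    simp [ringAct_single, Torus.one_pow]
  mul_smul s t x := by
    apply chart_ext
    intro m
    change x (ringAct σ (s * t)⁻¹ _) = x (ringAct σ t⁻¹ (ringAct σ s⁻¹ _))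
    simp [ringAct_single, Torus.mul_pow, Torus.inv_pow, mul_comm]

lemma chart_smul_apply {σ : PointedCone ℝ V} (t : Torus N) (x : AffineChart N σ)
    (f : CoordRing N σ) : (t • x) f = x (ringAct σ t⁻¹ f) := rfl

/-- The element `c z^m` of `ℂ[σ^∨ ∩ M]`, understood as `0` when `m` is not in `σ^∨`. -/
noncomputable def monom (σ : PointedCone ℝ V) (m : dualLattice N) (c : ℂ) : CoordRing N σ :=
  open Classical in if h : m ∈ dualMonoid N σ then AddMonoidAlgebra.single ⟨m, h⟩ c else 0

/-- The value of `z^m` at a point of `U(σ)`. -/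
noncomputable def charVal {σ : PointedCone ℝ V} (x : AffineChart N σ) (m : dualLattice N) : ℂ :=
  x (monom σ m 1)

lemma monom_of_mem {σ : PointedCone ℝ V} {m : dualLattice N} (h : m ∈ dualMonoid N σ) (c : ℂ) :
    monom σ m c = AddMonoidAlgebra.single ⟨m, h⟩ c := by
  simp [monom, h]

lemma apply_monom {σ : PointedCone ℝ V} (x : AffineChart N σ) (m : dualLattice N) (c : ℂ) :
    x (monom σ m c) = c * charVal x m := by
  unfold charVal
  by_cases h : m ∈ dualMonoid N σ
  · rw [monom_of_mem h, monom_of_mem h, ← smul_eq_mul, ← map_smul]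
    congr 1
    simp
  · simp [monom, h]

lemma charVal_zero {σ : PointedCone ℝ V} (x : AffineChart N σ) : charVal x 0 = 1 := by
  unfold charVal
  rw [monom_of_mem (zero_mem _)]
  exact map_one x

lemma charVal_add {σ : PointedCone ℝ V} (x : AffineChart N σ) {m m' : dualLattice N}
    (h : m ∈ dualMonoid N σ) (h' : m' ∈ dualMonoid N σ) :
    charVal x (m + m') = charVal x m * charVal x m' := by
  unfold charVal
  rw [monom_of_mem h, monom_of_mem h', monom_of_mem (add_mem h h'), ← map_mul,
    AddMonoidAlgebra.single_mul_single]
  simp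

lemma charVal_nsmul {σ : PointedCone ℝ V} (x : AffineChart N σ) {m : dualLattice N}
    (h : m ∈ dualMonoid N σ) (k : ℕ) : charVal x (k • m) = charVal x m ^ k := by
  induction k with
  | zero => simp [charVal_zero]
  | succ k ih => rw [succ_nsmul, charVal_add x (nsmul_mem h k) h, ih, pow_succ]

lemma chart_ext' {σ : PointedCone ℝ V} {x y : AffineChart N σ}
    (h : ∀ m ∈ dualMonoid N σ, charVal x m = charVal y m) : x = y := by
  apply chart_ext
  intro m
  have := h m.1 m.2
  unfold charVal at this
  rwa [monom_of_mem m.2] at this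

lemma charVal_incl {τ σ : PointedCone ℝ V} (h : τ ≤ σ) (x : AffineChart N τ) {m : dualLattice N}
    (hm : m ∈ dualMonoid N σ) : charVal (chartIncl h x) m = charVal x m := by
  unfold charVal chartIncl
  rw [monom_of_mem hm, monom_of_mem (dualMonoid_anti h hm), AlgHom.comp_apply]
  congr 1
  simp [AddSubmonoid.inclusion]

lemma chartIncl_trans {ρ τ σ : PointedCone ℝ V} (h : ρ ≤ τ) (h' : τ ≤ σ) (x : AffineChart N ρ) :
    chartIncl h' (chartIncl h x) = chartIncl (h.trans h') x := by
  apply chart_ext'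
  intro m hm
  rw [charVal_incl _ _ hm, charVal_incl _ _ (dualMonoid_anti h' hm), charVal_incl _ _ hm]

lemma charVal_smul {σ : PointedCone ℝ V} (t : Torus N) (x : AffineChart N σ) (m : dualLattice N) :
    charVal (t • x) m = (t.pow m)⁻¹ * charVal x m := by
  by_cases h : m ∈ dualMonoid N σ
  · rw [← apply_monom]
    unfold charVal
    rw [chart_smul_apply, monom_of_mem h, monom_of_mem h, ringAct_single, Torus.inv_pow, one_mul]
  · simp [charVal, monom, h]

lemma chartIncl_smul {τ σ : PointedCone ℝ V} (h : τ ≤ σ) (t : Torus N) (x : AffineChart N τ) :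
    chartIncl h (t • x) = t • chartIncl h x := by
  apply chart_ext'
  intro m hm
  rw [charVal_incl _ _ hm, charVal_smul, charVal_smul, charVal_incl _ _ hm]

lemma IsFace.le {τ σ : PointedCone ℝ V} (h : IsFace N τ σ) : τ ≤ σ := by
  obtain ⟨m, -, hm⟩ := h
  exact fun x hx => ((hm x).1 hx).1

lemma exists_add_nsmul_mem {τ σ : PointedCone ℝ V} (hσ : IsRationalPolyhedral N σ)
    {m : dualLattice N} (h0 : ∀ x ∈ σ, 0 ≤ m.1 x) (hm : ∀ x, x ∈ τ ↔ x ∈ σ ∧ m.1 x = 0)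
    {u : dualLattice N} (hu : u ∈ dualMonoid N τ) : ∃ k : ℕ, u + k • m ∈ dualMonoid N σ := by
  classical
  obtain ⟨S, -, hS⟩ := hσ
  have hSσ : ∀ x ∈ S, x ∈ σ := by
    intro x hx
    rw [hS]
    exact PointedCone.subset_hull hx
  have key : ∀ x ∈ S, ∃ k : ℕ, ∀ l : ℕ, k ≤ l → 0 ≤ u.1 x + l * m.1 x := by
    intro x hx
    rcases (h0 x (hSσ x hx)).eq_or_lt with h | h
    · exact ⟨0, fun l _ => by
        rw [← h, mul_zero, add_zero]
        exact hu x ((hm x).2 ⟨hSσ x hx, h.symm⟩)⟩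
    · obtain ⟨k, hk⟩ := exists_nat_ge (-(u.1 x) / m.1 x)
      refine ⟨k, fun l hl => ?_⟩
      rw [div_le_iff₀ h] at hk
      have : (k : ℝ) * m.1 x ≤ l * m.1 x := by gcongr
      linarith
  choose! K hK using key
  refine ⟨S.sup K, fun x hx => ?_⟩
  rw [hS] at hx
  induction hx using Submodule.span_induction with
  | mem y hy => simpa using hK y hy _ (Finset.le_sup hy)
  | zero => simp
  | add y z _ _ hy hz => rw [map_add]; exact add_nonneg hy hz
  | smul c y _ hy =>
    change 0 ≤ (u + S.sup K • m).1 ((c : ℝ) • y)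
    rw [map_smul]
    exact mul_nonneg c.2 hy

lemma neg_mem_dualMonoid {τ σ : PointedCone ℝ V} {m : dualLattice N}
    (hm : ∀ x, x ∈ τ ↔ x ∈ σ ∧ m.1 x = 0) : -m ∈ dualMonoid N τ := by
  intro x hx
  simp [((hm x).1 hx).2]

lemma charVal_ne_zero {τ σ : PointedCone ℝ V} {m : dualLattice N} (h : τ ≤ σ)
    (h0 : ∀ x ∈ σ, 0 ≤ m.1 x) (hm : ∀ x, x ∈ τ ↔ x ∈ σ ∧ m.1 x = 0) (y : AffineChart N τ) :
    charVal y m ≠ 0 := by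
  intro hy
  have := charVal_add y (dualMonoid_anti h h0) (neg_mem_dualMonoid hm)
  rw [add_neg_cancel, charVal_zero, hy, zero_mul] at this
  exact one_ne_zero this

/-- The chart of a face is a subset of the chart of the cone. -/
lemma chartIncl_injective {τ σ : PointedCone ℝ V} (hσ : IsRationalPolyhedral N σ)
    (hf : IsFace N τ σ) (h : τ ≤ σ) :
    Function.Injective (chartIncl h : AffineChart N τ → AffineChart N σ) := by
  obtain ⟨m, h0, hm⟩ := hf
  intro x y hxy
  apply chart_ext'
  intro u hu
  obtain ⟨k, hk⟩ := exists_add_nsmul_mem hσ h0 hm hu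
  have hmτ : m ∈ dualMonoid N τ := dualMonoid_anti h h0
  have h1 : charVal x (u + k • m) = charVal y (u + k • m) := by
    rw [← charVal_incl h x hk, ← charVal_incl h y hk, hxy]
  have h2 : charVal x m = charVal y m := by
    rw [← charVal_incl h x h0, ← charVal_incl h y h0, hxy]
  rw [charVal_add _ hu (nsmul_mem hmτ k), charVal_add _ hu (nsmul_mem hmτ k), charVal_nsmul _ hmτ,
    charVal_nsmul _ hmτ, h2] at h1
  exact mul_right_cancel₀ (pow_ne_zero k (charVal_ne_zero h h0 hm y)) h1

/-- The chart of the face `σ ∩ m^⊥` is the locus where `z^m` does not vanish. -/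
lemma exists_chartIncl_eq {τ σ : PointedCone ℝ V} (hσ : IsRationalPolyhedral N σ)
    {m : dualLattice N} (h0 : ∀ x ∈ σ, 0 ≤ m.1 x) (hm : ∀ x, x ∈ τ ↔ x ∈ σ ∧ m.1 x = 0)
    (h : τ ≤ σ) (x : AffineChart N σ) (hx : charVal x m ≠ 0) :
    ∃ y : AffineChart N τ, chartIncl h y = x := by
  have key : ∀ u : dualMonoid N τ, ∃ k : ℕ, u.1 + k • m ∈ dualMonoid N σ :=
    fun u => exists_add_nsmul_mem hσ h0 hm u.2
  choose K hK using key
  have hmσ : m ∈ dualMonoid N σ := h0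
  have indep : ∀ (u : dualLattice N) (k l : ℕ), u + k • m ∈ dualMonoid N σ →
      u + l • m ∈ dualMonoid N σ →
      charVal x (u + k • m) / charVal x m ^ k = charVal x (u + l • m) / charVal x m ^ l := by
    intro u k l hk hl
    rw [div_eq_div_iff (pow_ne_zero _ hx) (pow_ne_zero _ hx), ← charVal_nsmul _ hmσ,
      ← charVal_nsmul _ hmσ, ← charVal_add _ hk (nsmul_mem hmσ l),
      ← charVal_add _ hl (nsmul_mem hmσ k)]
    congr 1
    abel
  let φ : Multiplicative (dualMonoid N τ) →* ℂ :=
    { toFun := fun u => charVal x (u.toAdd.1 + K u.toAdd • m) / charVal x m ^ K u.toAdd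
      map_one' := by
        rw [indep _ _ 0 (hK _) (by simp)]
        simp [charVal_zero]
      map_mul' := by
        intro a b
        have e : (a.toAdd + b.toAdd).1 + (K a.toAdd + K b.toAdd) • m
            = (a.toAdd.1 + K a.toAdd • m) + (b.toAdd.1 + K b.toAdd • m) := by
          rw [add_smul, AddSubmonoid.coe_add]
          abel
        rw [toAdd_mul, indep _ _ (K a.toAdd + K b.toAdd) (hK _)
          (by rw [e]; exact add_mem (hK _) (hK _)), e, charVal_add _ (hK _) (hK _), pow_add,
          mul_div_mul_comm] }
  refine ⟨AddMonoidAlgebra.lift ℂ ℂ _ φ, ?_⟩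
  apply chart_ext'
  intro u hu
  rw [charVal_incl h _ hu]
  unfold charVal
  rw [monom_of_mem (dualMonoid_anti h hu), AddMonoidAlgebra.lift_single, one_smul]
  change charVal x (u + K ⟨u, _⟩ • m) / charVal x m ^ K ⟨u, _⟩ = charVal x u
  rw [indep u _ 0 (hK ⟨u, dualMonoid_anti h hu⟩) (by simpa using hu)]
  simp

/-! ## The toric variety -/

/-- If a point of `U(σ₁ ∩ σ₂)` and a point of `U(σ₂ ∩ σ₃)` agree in `U(σ₂)`, both come from one
point of `U(σ₁ ∩ σ₂ ∩ σ₃)`. -/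
lemma CompleteFan.triple (F : CompleteFan N) {σ₁ σ₂ σ₃ : PointedCone ℝ V}
    (h₁ : σ₁ ∈ F.cones) (h₂ : σ₂ ∈ F.cones) (h₃ : σ₃ ∈ F.cones)
    (z : AffineChart N (σ₁ ⊓ σ₂)) (y : AffineChart N (σ₂ ⊓ σ₃))
    (h : chartIncl inf_le_right z = chartIncl inf_le_left y) :
    ∃ w : AffineChart N (σ₁ ⊓ σ₂ ⊓ σ₃), chartIncl inf_le_left w = z ∧
      chartIncl (le_inf (inf_le_left.trans inf_le_right) inf_le_right) w = y := by
  have hf := F.inter_face σ₂ h₂ σ₃ h₃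
  have h12 : σ₁ ⊓ σ₂ ∈ F.cones := F.face_mem σ₁ h₁ _ (F.inter_face σ₁ h₁ σ₂ h₂)
  obtain ⟨m, h0, hm⟩ := id hf
  have hmσ : m ∈ dualMonoid N σ₂ := h0
  have hzm : charVal z m ≠ 0 := by
    rw [← charVal_incl inf_le_right z hmσ, h, charVal_incl inf_le_left y hmσ]
    exact charVal_ne_zero inf_le_left h0 hm y
  obtain ⟨w, hw⟩ := exists_chartIncl_eq (τ := σ₁ ⊓ σ₂ ⊓ σ₃) (F.rational _ h12) (m := m)
    (fun x hx => h0 x hx.2) (fun x => by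
      constructor
      · intro hx
        exact ⟨hx.1, ((hm x).1 ⟨hx.1.2, hx.2⟩).2⟩
      · intro hx
        exact ⟨hx.1, ((hm x).2 ⟨hx.1.2, hx.2⟩).2⟩) inf_le_left z hzm
  refine ⟨w, hw, ?_⟩
  apply chartIncl_injective (F.rational _ h₂) hf inf_le_left
  rw [← h, ← hw, chartIncl_trans, chartIncl_trans]

/-- The gluing relation: a point of `U(σ)` and a point of `U(τ)` are identified when they are the
same point of `U(σ ∩ τ)`. -/
def CompleteFan.glue (F : CompleteFan N) : Setoid (Σ σ : F.cones, AffineChart N σ.1) where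
  r a b := ∃ z : AffineChart N (a.1.1 ⊓ b.1.1),
    chartIncl inf_le_left z = a.2 ∧ chartIncl inf_le_right z = b.2
  iseqv :=
    { refl := fun a => ⟨chartIncl (σ := a.1.1 ⊓ a.1.1) (le_inf le_rfl le_rfl) a.2, by
        constructor <;>
        · rw [chartIncl_trans]
          apply chart_ext'
          intro m hm
          rw [charVal_incl _ _ hm]⟩
      symm := by
        rintro a b ⟨z, h1, h2⟩
        exact ⟨chartIncl (le_of_eq (inf_comm _ _)) z, by rw [chartIncl_trans, h2],
          by rw [chartIncl_trans, h1]⟩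
      trans := by
        rintro a b c ⟨z, h1, h2⟩ ⟨y, h3, h4⟩
        obtain ⟨w, hw1, hw2⟩ := F.triple a.1.2 b.1.2 c.1.2 z y (h2.trans h3.symm)
        refine ⟨chartIncl (le_inf (inf_le_left.trans inf_le_left) inf_le_right) w, ?_, ?_⟩
        · rw [← h1, ← hw1, chartIncl_trans, chartIncl_trans]
        · rw [← h4, ← hw2, chartIncl_trans, chartIncl_trans] }

/-- The points of the toric variety `X_Σ`, the direct limit of the affine charts `U(σ)`. -/
def CompleteFan.Variety (F : CompleteFan N) : Type v := Quotient F.glue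

/-- The inclusion of the chart `U(σ)` in `X_Σ`. -/
def CompleteFan.toVariety (F : CompleteFan N) (σ : F.cones) (x : AffineChart N σ.1) : F.Variety :=
  Quotient.mk F.glue ⟨σ, x⟩

/-- The inclusion of the chart `U(σ)` of a full-dimensional cone in `X_Σ`. -/
def CompleteFan.MaxCone.pt {F : CompleteFan N} (σ : F.MaxCone) (x : AffineChart N σ.1) :
    F.Variety :=
  F.toVariety ⟨σ.1, σ.2.1⟩ x

lemma CompleteFan.MaxCone.pt_eq_iff {F : CompleteFan N} {σ τ : F.MaxCone} {x : AffineChart N σ.1}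
    {y : AffineChart N τ.1} : σ.pt x = τ.pt y ↔ ∃ z : AffineChart N (σ.1 ⊓ τ.1),
      chartIncl inf_le_left z = x ∧ chartIncl inf_le_right z = y :=
  Quotient.eq (r := F.glue)

lemma CompleteFan.MaxCone.pt_injective {F : CompleteFan N} {σ : F.MaxCone}
    {x y : AffineChart N σ.1} (h : σ.pt x = σ.pt y) : x = y := by
  obtain ⟨z, rfl, rfl⟩ := pt_eq_iff.1 h
  rfl

/-- The torus action on `X_Σ`. -/
noncomputable instance varietyAction (F : CompleteFan N) : MulAction (Torus N) F.Variety where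
  smul t := Quotient.map' (fun a => ⟨a.1, t • a.2⟩) (by
    rintro a b ⟨z, h1, h2⟩
    exact ⟨t • z, by rw [chartIncl_smul, h1], by rw [chartIncl_smul, h2]⟩)
  one_smul := by
    rintro ⟨a⟩
    change Quotient.mk F.glue ⟨a.1, (1 : Torus N) • a.2⟩ = Quotient.mk F.glue a
    rw [one_smul]
  mul_smul := by
    rintro s t ⟨a⟩
    change Quotient.mk F.glue ⟨a.1, (s * t) • a.2⟩ = Quotient.mk F.glue ⟨a.1, s • t • a.2⟩
    rw [mul_smul]

lemma CompleteFan.MaxCone.smul_pt {F : CompleteFan N} (σ : F.MaxCone) (t : Torus N)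
    (x : AffineChart N σ.1) : t • σ.pt x = σ.pt (t • x) := rfl

/-! ## Toric vector bundles -/

/-- The value at `(t, x)` of a regular function on `T × U(σ)`, whose coordinate ring is
`ℂ[M × (σ^∨ ∩ M)]`. -/
noncomputable def evalTorusChart {σ : PointedCone ℝ V} (t : Torus N) (x : AffineChart N σ) :
    AddMonoidAlgebra ℂ (dualLattice N × dualMonoid N σ) →ₐ[ℂ] ℂ :=
  AddMonoidAlgebra.lift ℂ ℂ (dualLattice N × dualMonoid N σ)
    { toFun := fun a => t.pow a.toAdd.1 * charVal x a.toAdd.2.1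
      map_one' := by
        change t.pow 0 * charVal x 0 = 1
        rw [Torus.pow_zero, charVal_zero, one_mul]
      map_mul' := by
        intro a b
        change t.pow (a.toAdd.1 + b.toAdd.1) * charVal x (a.toAdd.2.1 + b.toAdd.2.1) = _
        rw [Torus.pow_add, charVal_add x a.toAdd.2.2 b.toAdd.2.2]
        ring }

/-- A toric (torus-equivariant algebraic) vector bundle on `X_Σ`, given by its fibres, by algebraic
trivializations (local frames) over the affine charts `U(σ)` of the full-dimensional cones, which
cover `X_Σ` and over which every toric vector bundle is trivial, with regular transition functions, and by an algebraic action of the torus that lifts the action on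
`X_Σ` and is linear on fibres. A vector is written in a local frame as a row of coordinates. -/
structure ToricVectorBundle (F : CompleteFan N) where
  /-- The fibre over a point. -/
  Fiber : F.Variety → Type w
  [addCommGroup : ∀ p, AddCommGroup (Fiber p)]
  [module : ∀ p, Module ℂ (Fiber p)]
  /-- The index set of the local frame over `U(σ)`. -/
  Frame : F.MaxCone → Type u
  [fintype : ∀ σ, Fintype (Frame σ)]
  /-- The coordinates in the local frame over `U(σ)`, at the point `p = x` of `U(σ)`. -/
  triv : ∀ (σ : F.MaxCone) (x : AffineChart N σ.1) (p : F.Variety), σ.pt x = p →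
    (Fiber p ≃ₗ[ℂ] (Frame σ → ℂ))
  transition_regular : ∀ σ₁ σ₂ : F.MaxCone,
    ∃ G : Matrix (Frame σ₁) (Frame σ₂) (CoordRing N (σ₁.1 ⊓ σ₂.1)),
      ∀ (z : AffineChart N (σ₁.1 ⊓ σ₂.1)) (p : F.Variety)
        (h₁ : σ₁.pt (chartIncl inf_le_left z) = p) (h₂ : σ₂.pt (chartIncl inf_le_right z) = p)
        (v : Fiber p), triv σ₂ _ p h₂ v = Matrix.vecMul (triv σ₁ _ p h₁ v) (G.map z)
  /-- The action of `t` as a linear map from the fibre over `p` to the fibre over `q = t • p`. -/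
  act : ∀ (t : Torus N) (p q : F.Variety), t • p = q → (Fiber p →ₗ[ℂ] Fiber q)
  act_one : ∀ (p : F.Variety) (v : Fiber p), act 1 p p (one_smul _ p) v = v
  act_mul : ∀ (s t : Torus N) (p q r : F.Variety) (hq : t • p = q) (hr : s • q = r)
    (v : Fiber p), act (s * t) p r (by rw [mul_smul, hq, hr]) v = act s q r hr (act t p q hq v)
  act_regular : ∀ σ : F.MaxCone,
    ∃ A : Matrix (Frame σ) (Frame σ) (AddMonoidAlgebra ℂ (dualLattice N × dualMonoid N σ.1)),
      ∀ (t : Torus N) (x : AffineChart N σ.1) (p q : F.Variety) (hp : σ.pt x = p)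
        (hq : t • p = q) (v : Fiber p),
        triv σ (t • x) q (by rw [← hq, ← hp, CompleteFan.MaxCone.smul_pt]) (act t p q hq v) =
          Matrix.vecMul (triv σ x p hp v) (A.map (evalTorusChart t x))

attribute [instance] ToricVectorBundle.addCommGroup ToricVectorBundle.module
  ToricVectorBundle.fintype

namespace ToricVectorBundle

variable {F : CompleteFan N}

/-- A fibrewise linear map covering the identity of `X_Σ` is regular if in the local frames over
each `U(σ)` it is given by a matrix of regular functions on `U(σ)`. -/
def IsRegularMap (E E' : ToricVectorBundle F) (Φ : ∀ p, E.Fiber p →ₗ[ℂ] E'.Fiber p) : Prop :=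
  ∀ σ : F.MaxCone, ∃ H : Matrix (E.Frame σ) (E'.Frame σ) (CoordRing N σ.1),
    ∀ (x : AffineChart N σ.1) (v : E.Fiber (σ.pt x)),
      E'.triv σ x _ rfl (Φ _ v) = Matrix.vecMul (E.triv σ x _ rfl v) (H.map x)

/-- Isomorphism of toric vector bundles: an isomorphism of algebraic vector bundles covering the
identity of `X_Σ` and commuting with the torus actions. -/
def Isomorphic (E E' : ToricVectorBundle F) : Prop :=
  ∃ Φ : ∀ p, E.Fiber p ≃ₗ[ℂ] E'.Fiber p,
    IsRegularMap E E' (fun p => (Φ p).toLinearMap) ∧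
    IsRegularMap E' E (fun p => (Φ p).symm.toLinearMap) ∧
    ∀ (t : Torus N) (p q : F.Variety) (h : t • p = q) (v : E.Fiber p),
      Φ q (E.act t p q h v) = E'.act t p q h (Φ p v)

end ToricVectorBundle

end Fans

/-! ## Cone complexes and branched coverings -/

section ConeComplexes

/-- A collection of subsets ("cones") of a space `X`, with a group of continuous functions on each
of them. (The values of `lat` on subsets that are not in `cones` are irrelevant.) -/
structure ConeSystem (X : Type u) [TopologicalSpace X] where
  cones : Set (Set X)
  lat : ∀ σ : Set X, AddSubgroup C(σ, ℝ)

namespace ConeSystem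

variable {X : Type u} [TopologicalSpace X] (C : ConeSystem X)

/-- The face of `σ` where a nonnegative function `u` in `M(σ)` vanishes. -/
def face (σ : Set X) (u : C(σ, ℝ)) : Set X := {x | ∃ h : x ∈ σ, u ⟨x, h⟩ = 0}

/-- The relative interior of `σ`: the points of `σ` on no proper face. -/
def relInt (σ : Set X) : Set X :=
  {x | ∃ h : x ∈ σ, ∀ u ∈ C.lat σ, (∀ y, 0 ≤ u y) → u ⟨x, h⟩ = 0 → u = 0}

/-- The axioms of a cone complex. The dual of `M(σ) ⊗ ℝ` is the space of additive maps
`M(σ) → ℝ` with the topology of pointwise convergence; a rational polyhedral cone in it is one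
generated by finitely many integral functionals `M(σ) → ℤ`. -/
structure IsConeComplex : Prop where
  finite : C.cones.Finite
  closed : ∀ σ ∈ C.cones, IsClosed σ
  fg : ∀ σ ∈ C.cones, (C.lat σ).FG
  /-- `x ↦ (u ↦ u x)` is a homeomorphism onto its image. -/
  embedding : ∀ σ ∈ C.cones,
    Topology.IsEmbedding (fun (x : σ) (u : C.lat σ) => (u : C(σ, ℝ)) x)
  /-- The image of `x ↦ (u ↦ u x)` is a rational polyhedral cone. -/
  cone : ∀ σ ∈ C.cones, ∃ S : Finset (C.lat σ →+ ℤ),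
    Set.range (fun (x : σ) (u : C.lat σ) => (u : C(σ, ℝ)) x) =
      {f | ∃ c : (C.lat σ →+ ℤ) → ℝ, (∀ s, 0 ≤ c s) ∧ ∀ u, f u = ∑ s ∈ S, c s * (s u : ℝ)}
  face_mem : ∀ σ ∈ C.cones, ∀ u ∈ C.lat σ, (∀ y, 0 ≤ u y) → face σ u ∈ C.cones
  face_lat : ∀ σ ∈ C.cones, ∀ u ∈ C.lat σ, (∀ y, 0 ≤ u y) → ∀ v : C(face σ u, ℝ),
    v ∈ C.lat (face σ u) ↔ ∃ w ∈ C.lat σ, ∀ x : face σ u, v x = w ⟨x.1, x.2.1⟩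
  /-- `X` is the disjoint union of the relative interiors of the cones. -/
  partition : ∀ x : X, ∃! σ, σ ∈ C.cones ∧ x ∈ C.relInt σ

variable {Y : Type v} [TopologicalSpace Y]

/-- Morphisms of cone complexes. -/
def IsMorphism (C : ConeSystem X) (D : ConeSystem Y) (f : X → Y) : Prop :=
  Continuous f ∧ ∀ σ ∈ C.cones, ∃ τ ∈ D.cones, ∃ h : Set.MapsTo f σ τ,
    ∀ u ∈ D.lat τ, ∃ v ∈ C.lat σ, ∀ x : σ, v x = u ⟨f x, h x.2⟩

/-- Weights: positive integers, constant on the relative interior of each cone. -/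
def IsWeight (μ : X → ℕ) : Prop :=
  (∀ x, 0 < μ x) ∧ ∀ σ ∈ C.cones, ∀ x ∈ C.relInt σ, ∀ y ∈ C.relInt σ, μ x = μ y

/-- The trace at `y` of the weight `μ` by the restriction of `f` to the subset `A`. -/
noncomputable def trace (f : X → Y) (μ : X → ℕ) (A : Set X) (y : Y) : ℕ :=
  ∑ᶠ x ∈ A ∩ f ⁻¹' {y}, μ x

/-- Branched covering maps `π : (L, Σ_L, μ) → (B, Σ)`. -/
structure IsBranchedCovering (C : ConeSystem X) (μ : X → ℕ) (D : ConeSystem Y) (π : X → Y) :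
    Prop where
  morphism : IsMorphism C D π
  surjective : Function.Surjective π
  /-- `π` maps every cone homeomorphically to a cone. -/
  image_mem : ∀ σ ∈ C.cones, π '' σ ∈ D.cones
  homeo : ∀ σ ∈ C.cones, Topology.IsEmbedding (fun x : σ => π x)
  /-- The identification of `σ` with its image identifies the lattices of functions. -/
  lat_iff : ∀ σ ∈ C.cones, ∀ v : C(σ, ℝ), v ∈ C.lat σ ↔
    ∃ u ∈ D.lat (π '' σ), ∀ x : σ, v x = u ⟨π x, Set.mem_image_of_mem π x.2⟩
  /-- Over a connected open set, each connected component of the preimage has constant degree. -/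
  trace_const : ∀ U : Set Y, IsOpen U → IsConnected U → ∀ y ∈ π ⁻¹' U, ∀ a ∈ U, ∀ b ∈ U,
    trace π μ (connectedComponentIn (π ⁻¹' U) y) a = trace π μ (connectedComponentIn (π ⁻¹' U) y) b

end ConeSystem

end ConeComplexes

/-! ## Tropical Lagrangian multi-sections -/

section MultiSections

variable {V : Type v} [NormedAddCommGroup V] [NormedSpace ℝ V] {N : Submodule ℤ V}

/-- The cone complex `(N_ℝ, Σ)` of a complete fan: the functions on a cone are the restrictions of
elements of `M`. -/
def CompleteFan.system (F : CompleteFan N) : ConeSystem V where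
  cones := {s | ∃ σ ∈ F.cones, s = (σ : Set V)}
  lat s :=
    { carrier := {f | ∃ m : dualLattice N, ∀ x : s, f x = m.1 x}
      zero_mem' := ⟨0, fun x => by simp⟩
      add_mem' := by
        rintro f g ⟨m, hm⟩ ⟨m', hm'⟩
        exact ⟨m + m', fun x => by simp [hm, hm']⟩
      neg_mem' := by
        rintro f ⟨m, hm⟩
        exact ⟨-m, fun x => by simp [hm]⟩ }

/-- Tropical Lagrangian multi-sections of rank `r` over the fan `F`. -/
structure MultiSection (F : CompleteFan N) (r : ℕ) where
  /-- The domain `L`. -/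
  Dom : Type u
  [top : TopologicalSpace Dom]
  sys : ConeSystem Dom
  isConeComplex : sys.IsConeComplex
  /-- The weight `μ`. -/
  μ : Dom → ℕ
  isWeight : sys.IsWeight μ
  /-- The projection `π`. -/
  π : Dom → V
  isCovering : ConeSystem.IsBranchedCovering sys μ F.system π
  rank_eq : ∀ x, ConeSystem.trace π μ Set.univ x = r
  /-- The piecewise linear function `φ`. -/
  φ : Dom → ℝ
  piecewiseLinear : ∀ σ ∈ sys.cones, ∃ u ∈ sys.lat σ, ∀ x : σ, φ x = u x

attribute [instance] MultiSection.top

namespace MultiSection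

variable {F : CompleteFan N} {r : ℕ}

/-- The order `L₁ ≤ L₂`. -/
def Leq (L₁ L₂ : MultiSection.{u} F r) : Prop :=
  ∃ f : L₂.Dom → L₁.Dom, Function.Surjective f ∧ ConeSystem.IsMorphism L₂.sys L₁.sys f ∧
    (∀ x, L₁.π (f x) = L₂.π x) ∧ (∀ y, ConeSystem.trace f L₂.μ Set.univ y = L₁.μ y) ∧
    ∀ x, L₁.φ (f x) = L₂.φ x

/-- A multi-section is connected if its domain is. -/
def IsConn (L : MultiSection F r) : Prop := ConnectedSpace L.Dom

/-- The relation `∼_c` between connected multi-sections (of the same rank). -/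
def SimC (L₁ L₂ : MultiSection.{u} F r) : Prop :=
  L₁.IsConn ∧ L₂.IsConn ∧ ∃ L : MultiSection.{u} F r, L.Leq L₁ ∧ L.Leq L₂

/-- Combinatorial equivalence: there is a finite sequence of multi-sections from `L₁` to `L₂` with
consecutive terms related by `∼_c`. -/
def CombEquiv (L₁ L₂ : MultiSection.{u} F r) : Prop :=
  Relation.ReflTransGen SimC L₁ L₂

/-- The weight of a cone: the constant value of `μ` on its relative interior. -/
noncomputable def weight (L : MultiSection F r) (s : Set L.Dom) : ℕ :=
  open Classical in if h : (L.sys.relInt s).Nonempty then L.μ h.some else 0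

/-- The lifts of a cone `σ` of the fan, counted with multiplicity. -/
abbrev Lift (L : MultiSection F r) (σ : PointedCone ℝ V) : Type u :=
  Σ s : {s : Set L.Dom // s ∈ L.sys.cones ∧ L.π '' s = σ}, Fin (L.weight s.1)

noncomputable instance liftFintype (L : MultiSection F r) (σ : PointedCone ℝ V) :
    Fintype (L.Lift σ) := by
  have : Finite {s : Set L.Dom // s ∈ L.sys.cones ∧ L.π '' s = σ} :=
    (L.isConeComplex.finite.subset (fun s hs => hs.1)).to_subtype
  exact Fintype.ofFinite _

noncomputable instance liftDecidableEq (L : MultiSection F r) (σ : PointedCone ℝ V) :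
    DecidableEq (L.Lift σ) := Classical.decEq _

lemma exists_slope (L : MultiSection F r) {s : Set L.Dom} (hs : s ∈ L.sys.cones) :
    ∃ m : dualLattice N, ∀ x ∈ s, L.φ x = m.1 (L.π x) := by
  obtain ⟨u, hu, hφ⟩ := L.piecewiseLinear s hs
  obtain ⟨u', ⟨m, hm⟩, hu'⟩ := (L.isCovering.lat_iff s hs u).1 hu
  refine ⟨m, fun x hx => ?_⟩
  rw [hφ ⟨x, hx⟩, hu' ⟨x, hx⟩, hm]

/-- The slope `m(σ')` in `M` of `φ` on a lift `σ'` of a full-dimensional cone `σ`. (It is unique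
because the cone spans the space.) -/
noncomputable def slope (L : MultiSection F r) {σ : PointedCone ℝ V} (α : L.Lift σ) :
    dualLattice N :=
  (L.exists_slope α.1.2.1).choose

/-- Kaneyama data. Invertibility of the matrices follows from the cocycle conditions; see
`KaneyamaData.mul_inv`. -/
structure KaneyamaData (L : MultiSection F r) where
  g : ∀ σ₁ σ₂ : F.MaxCone, Matrix (L.Lift σ₁.1) (L.Lift σ₂.1) ℂ
  g_self : ∀ σ, g σ σ = 1
  g_supp : ∀ σ₁ σ₂ α β, g σ₁ σ₂ α β ≠ 0 →
    (α.1.1 ∩ β.1.1).Nonempty ∧ L.slope α - L.slope β ∈ dualMonoid N (σ₁.1 ⊓ σ₂.1)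
  g_mul : ∀ σ₁ σ₂ σ₃, g σ₁ σ₂ * g σ₂ σ₃ = g σ₁ σ₃

variable {L : MultiSection F r}

lemma KaneyamaData.mul_inv (g : L.KaneyamaData) (σ₁ σ₂ : F.MaxCone) :
    g.g σ₁ σ₂ * g.g σ₂ σ₁ = 1 := by
  rw [g.g_mul, g.g_self]

/-- The square matrices over the lifts of `σ` that may be nonzero at `(α, β)` only if
`m(α) - m(β)` is in `σ^∨`. -/
def IsAdapted (L : MultiSection F r) (σ : PointedCone ℝ V)
    (h : Matrix (L.Lift σ) (L.Lift σ) ℂ) : Prop :=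
  ∀ α β, h α β ≠ 0 → L.slope α - L.slope β ∈ dualMonoid N σ

/-- The subalgebra of adapted matrices. -/
def adaptedSubalgebra (L : MultiSection F r) (σ : PointedCone ℝ V) :
    Subalgebra ℂ (Matrix (L.Lift σ) (L.Lift σ) ℂ) where
  carrier := {h | L.IsAdapted σ h}
  mul_mem' := by
    intro a b ha hb α β hne
    rw [Matrix.mul_apply] at hne
    obtain ⟨γ, -, hγ⟩ := Finset.exists_ne_zero_of_sum_ne_zero hne
    have := add_mem (ha α γ (left_ne_zero_of_mul hγ)) (hb γ β (right_ne_zero_of_mul hγ))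
    rwa [sub_add_sub_cancel] at this
  add_mem' := by
    intro a b ha hb α β hne
    by_cases h : a α β = 0
    · exact hb α β (fun h' => hne (by simp [h, h']))
    · exact ha α β h
  algebraMap_mem' := by
    intro c α β hne
    by_cases h : α = β
    · subst h
      simp
    · exact absurd (by simp [Matrix.algebraMap_matrix_apply, h]) hne

lemma IsAdapted.inv {σ : PointedCone ℝ V} (h : (Matrix (L.Lift σ) (L.Lift σ) ℂ)ˣ)
    (hh : L.IsAdapted σ h.val) : L.IsAdapted σ h⁻¹.val := by
  let A := L.adaptedSubalgebra σ
  let f : A →ₗ[ℂ] A := LinearMap.mulLeft ℂ (⟨h.val, hh⟩ : A)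
  have hf : Function.Injective f := by
    intro a b hab
    have h1 : h.val * a.1 = h.val * b.1 := congrArg Subtype.val hab
    apply Subtype.ext
    simpa using congrArg (fun x => h⁻¹.val * x) h1
  obtain ⟨k, hk⟩ := LinearMap.surjective_of_injective hf 1
  have h1 : h.val * k.1 = 1 := congrArg Subtype.val hk
  have h2 : h⁻¹.val = k.1 := Units.inv_eq_of_mul_eq_one_right h1
  rw [h2]
  exact k.2

/-- Equivalence of Kaneyama data. -/
def KaneyamaData.setoid (L : MultiSection F r) : Setoid L.KaneyamaData where
  r g g' := ∃ h : ∀ σ : F.MaxCone, (Matrix (L.Lift σ.1) (L.Lift σ.1) ℂ)ˣ,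
    (∀ σ, L.IsAdapted σ.1 (h σ).val) ∧
    ∀ σ₁ σ₂, (h σ₁).val * g.g σ₁ σ₂ = g'.g σ₁ σ₂ * (h σ₂).val
  iseqv :=
    { refl := fun g => ⟨fun _ => 1, fun σ => by
          rw [Units.val_one]
          exact (L.adaptedSubalgebra σ.1).one_mem, fun _ _ => by simp⟩
      symm := by
        rintro g g' ⟨h, h1, h2⟩
        refine ⟨fun σ => (h σ)⁻¹, fun σ => (h1 σ).inv, fun σ₁ σ₂ => ?_⟩
        have := congrArg (fun x => (h σ₁)⁻¹.val * x * (h σ₂)⁻¹.val) (h2 σ₁ σ₂)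
        simp only [← Matrix.mul_assoc, Units.inv_mul, Matrix.one_mul] at this
        rw [Matrix.mul_assoc _ (h σ₂).val, Units.mul_inv, Matrix.mul_one] at this
        exact this.symm
      trans := by
        rintro g g' g'' ⟨h, h1, h2⟩ ⟨k, k1, k2⟩
        refine ⟨fun σ => k σ * h σ, fun σ => (L.adaptedSubalgebra σ.1).mul_mem (k1 σ) (h1 σ),
          fun σ₁ σ₂ => ?_⟩
        rw [Units.val_mul, Units.val_mul, Matrix.mul_assoc, h2, ← Matrix.mul_assoc, k2,
          Matrix.mul_assoc] }

/-- The set `𝒦(L)` of equivalence classes of Kaneyama data. -/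
def KaneyamaClasses (L : MultiSection F r) : Type _ := Quotient (KaneyamaData.setoid L)

/-- The class of a Kaneyama datum. -/
def KaneyamaData.cls (g : L.KaneyamaData) : L.KaneyamaClasses := Quotient.mk _ g

/-! ## The toric vector bundle of a Kaneyama datum -/

/-- The transition matrix `G_{σ₁σ₂}`, with entries `g_{αβ} z^{m(α) - m(β)}`: the frame vector
`1(α)` over `U(σ₁)` is `∑_β g_{αβ} z^{m(α) - m(β)} 1(β)` in the frame over `U(σ₂)`. -/
noncomputable def KaneyamaData.transition (g : L.KaneyamaData) (σ₁ σ₂ : F.MaxCone) :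
    Matrix (L.Lift σ₁.1) (L.Lift σ₂.1) (CoordRing N (σ₁.1 ⊓ σ₂.1)) :=
  Matrix.of fun α β => monom (σ₁.1 ⊓ σ₂.1) (L.slope α - L.slope β) (g.g σ₁ σ₂ α β)

lemma KaneyamaData.transition_apply (g : L.KaneyamaData) {σ₁ σ₂ : F.MaxCone}
    (z : AffineChart N (σ₁.1 ⊓ σ₂.1)) (α β) :
    (g.transition σ₁ σ₂).map z α β = g.g σ₁ σ₂ α β * charVal z (L.slope α - L.slope β) := by
  simp [KaneyamaData.transition, apply_monom]

lemma KaneyamaData.transition_apply' (g : L.KaneyamaData) {σ₁ σ₂ : F.MaxCone}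
    {ρ : PointedCone ℝ V} (hρ : ρ ≤ σ₁.1 ⊓ σ₂.1) (w : AffineChart N ρ) (α β) :
    (g.transition σ₁ σ₂).map (chartIncl hρ w) α β =
      g.g σ₁ σ₂ α β * charVal w (L.slope α - L.slope β) := by
  rw [g.transition_apply]
  by_cases h : g.g σ₁ σ₂ α β = 0
  · simp [h]
  · rw [charVal_incl _ _ (g.g_supp _ _ _ _ h).2]

lemma KaneyamaData.transition_cocycle (g : L.KaneyamaData) {σ₁ σ₂ σ₃ : F.MaxCone}
    {ρ : PointedCone ℝ V} (h₁₂ : ρ ≤ σ₁.1 ⊓ σ₂.1) (h₂₃ : ρ ≤ σ₂.1 ⊓ σ₃.1) (h₁₃ : ρ ≤ σ₁.1 ⊓ σ₃.1)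
    (w : AffineChart N ρ) :
    (g.transition σ₁ σ₂).map (chartIncl h₁₂ w) * (g.transition σ₂ σ₃).map (chartIncl h₂₃ w) =
      (g.transition σ₁ σ₃).map (chartIncl h₁₃ w) := by
  ext α γ
  rw [Matrix.mul_apply, g.transition_apply', ← g.g_mul σ₁ σ₂ σ₃, Matrix.mul_apply, Finset.sum_mul]
  refine Finset.sum_congr rfl fun β _ => ?_
  rw [g.transition_apply', g.transition_apply']
  by_cases h : g.g σ₁ σ₂ α β = 0
  · simp [h]
  by_cases h' : g.g σ₂ σ₃ β γ = 0
  · simp [h']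
  have e := charVal_add w (dualMonoid_anti h₁₂ (g.g_supp _ _ _ _ h).2)
    (dualMonoid_anti h₂₃ (g.g_supp _ _ _ _ h').2)
  rw [sub_add_sub_cancel] at e
  rw [e]
  ring

/-- The fibre at `p` of the bundle glued from the trivial bundles over the charts `U(σ)` along the
transition matrices: families of coordinate rows, one for each chart containing `p`, that
correspond to each other under the transition matrices. -/
def KaneyamaData.fiber (g : L.KaneyamaData) (p : F.Variety) :
    Submodule ℂ (∀ a : (Σ σ : F.MaxCone, {x : AffineChart N σ.1 // σ.pt x = p}),
      L.Lift a.1.1 → ℂ) where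
  carrier := {v | ∀ (σ₁ σ₂ : F.MaxCone) (z : AffineChart N (σ₁.1 ⊓ σ₂.1))
    (h₁ : σ₁.pt (chartIncl inf_le_left z) = p) (h₂ : σ₂.pt (chartIncl inf_le_right z) = p),
    v ⟨σ₂, _, h₂⟩ = Matrix.vecMul (v ⟨σ₁, _, h₁⟩) ((g.transition σ₁ σ₂).map z)}
  zero_mem' := by
    intro σ₁ σ₂ z h₁ h₂
    simp
  add_mem' := by
    intro a b ha hb σ₁ σ₂ z h₁ h₂
    simp only [Pi.add_apply, Matrix.add_vecMul]
    rw [← ha σ₁ σ₂ z h₁ h₂, ← hb σ₁ σ₂ z h₁ h₂]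
  smul_mem' := by
    intro c a ha σ₁ σ₂ z h₁ h₂
    simp only [Pi.smul_apply, Matrix.smul_vecMul]
    rw [← ha σ₁ σ₂ z h₁ h₂]

lemma KaneyamaData.transition_self (g : L.KaneyamaData) (σ : F.MaxCone)
    (z : AffineChart N (σ.1 ⊓ σ.1)) : (g.transition σ σ).map z = 1 := by
  ext α β
  rw [g.transition_apply, g.g_self]
  by_cases h : α = β
  · subst h
    simp [charVal_zero]
  · simp [h]

/-- The coordinates of a vector of the fibre in the chart `U(σ)`. -/
def KaneyamaData.coord (g : L.KaneyamaData) (σ : F.MaxCone) (x : AffineChart N σ.1)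
    (p : F.Variety) (h : σ.pt x = p) : g.fiber p →ₗ[ℂ] (L.Lift σ.1 → ℂ) :=
  (LinearMap.proj (⟨σ, x, h⟩ : Σ σ : F.MaxCone, {x : AffineChart N σ.1 // σ.pt x = p})).comp
    (g.fiber p).subtype

lemma KaneyamaData.coord_transition (g : L.KaneyamaData) {σ₁ σ₂ : F.MaxCone} {p : F.Variety}
    (z : AffineChart N (σ₁.1 ⊓ σ₂.1)) (h₁ : σ₁.pt (chartIncl inf_le_left z) = p)
    (h₂ : σ₂.pt (chartIncl inf_le_right z) = p) (v : g.fiber p) :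
    g.coord σ₂ _ p h₂ v = Matrix.vecMul (g.coord σ₁ _ p h₁ v) ((g.transition σ₁ σ₂).map z) :=
  v.2 σ₁ σ₂ z h₁ h₂

lemma KaneyamaData.fiber_ext (g : L.KaneyamaData) {p : F.Variety} {v v' : g.fiber p}
    (h : ∀ σ x hx, g.coord σ x p hx v = g.coord σ x p hx v') : v = v' := by
  apply Subtype.ext
  funext a
  exact h a.1 a.2.1 a.2.2

lemma KaneyamaData.coord_bijective (g : L.KaneyamaData) (σ : F.MaxCone) (x : AffineChart N σ.1)
    (p : F.Variety) (h : σ.pt x = p) : Function.Bijective (g.coord σ x p h) := by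
  constructor
  · intro v v' hv
    apply g.fiber_ext
    intro τ y hy
    obtain ⟨z, rfl, rfl⟩ := CompleteFan.MaxCone.pt_eq_iff.1 (h.trans hy.symm)
    rw [g.coord_transition z h hy, g.coord_transition z h hy, hv]
  · intro v₀
    have key : ∀ a : (Σ σ : F.MaxCone, {x : AffineChart N σ.1 // σ.pt x = p}),
        ∃ z : AffineChart N (σ.1 ⊓ a.1.1),
          chartIncl inf_le_left z = x ∧ chartIncl inf_le_right z = a.2.1 :=
      fun a => CompleteFan.MaxCone.pt_eq_iff.1 (h.trans a.2.2.symm)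
    choose Z hZ₁ hZ₂ using key
    refine ⟨⟨fun a => Matrix.vecMul v₀ ((g.transition σ a.1).map (Z a)), ?_⟩, ?_⟩
    · intro σ₁ σ₂ z h₁ h₂
      rw [Matrix.vecMul_vecMul]
      obtain ⟨w, hw₁, hw₂⟩ := F.triple σ.2.1 σ₁.2.1 σ₂.2.1 (Z ⟨σ₁, _, h₁⟩) z (hZ₂ ⟨σ₁, _, h₁⟩)
      have hw₃ : chartIncl (le_inf (inf_le_left.trans inf_le_left) inf_le_right) w =
          Z ⟨σ₂, _, h₂⟩ := by
        apply chartIncl_injective (F.rational _ σ.2.1) (F.inter_face _ σ.2.1 _ σ₂.2.1) inf_le_left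
        rw [hZ₁ ⟨σ₂, _, h₂⟩, ← hZ₁ ⟨σ₁, _, h₁⟩, ← hw₁, chartIncl_trans, chartIncl_trans]
      have c := g.transition_cocycle inf_le_left
        (le_inf (inf_le_left.trans inf_le_right) inf_le_right)
        (le_inf (inf_le_left.trans inf_le_left) inf_le_right) w
      rw [hw₁, hw₂, hw₃] at c
      exact congrArg (Matrix.vecMul v₀) c.symm
    · change Matrix.vecMul v₀ ((g.transition σ σ).map _) = v₀
      rw [g.transition_self, Matrix.vecMul_one]

/-- The torus action on the fibres: `t · (p, 1(α)) = (t · p, t^{m(α)} 1(α))`. -/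
noncomputable def KaneyamaData.act (g : L.KaneyamaData) (t : Torus N) (p q : F.Variety)
    (h : t • p = q) : g.fiber p →ₗ[ℂ] g.fiber q where
  toFun v := ⟨fun a α => t.pow (L.slope α) * g.coord a.1 (t⁻¹ • a.2.1) p
      (by rw [← CompleteFan.MaxCone.smul_pt, a.2.2, ← h, inv_smul_smul]) v α, by
    intro σ₁ σ₂ z h₁ h₂
    have e₁ : σ₁.pt (chartIncl inf_le_left (t⁻¹ • z)) = p := by
      rw [chartIncl_smul, ← CompleteFan.MaxCone.smul_pt, h₁, ← h, inv_smul_smul]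
    have e₂ : σ₂.pt (chartIncl inf_le_right (t⁻¹ • z)) = p := by
      rw [chartIncl_smul, ← CompleteFan.MaxCone.smul_pt, h₂, ← h, inv_smul_smul]
    have key := g.coord_transition (t⁻¹ • z) e₁ e₂ v
    funext β
    dsimp only
    simp only [← chartIncl_smul]
    rw [key]
    simp only [Matrix.vecMul, dotProduct, Finset.mul_sum]
    refine Finset.sum_congr rfl fun α _ => ?_
    have e : t.pow (L.slope α) = t.pow (L.slope α - L.slope β) * t.pow (L.slope β) := by
      rw [← Torus.pow_add, sub_add_cancel]
    rw [g.transition_apply, g.transition_apply, charVal_smul, Torus.inv_pow, inv_inv, e]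
    ring⟩
  map_add' v v' := by
    apply Subtype.ext
    funext a α
    change t.pow (L.slope α) * g.coord _ _ _ _ (v + v') α =
      t.pow (L.slope α) * g.coord _ _ _ _ v α + t.pow (L.slope α) * g.coord _ _ _ _ v' α
    rw [map_add, Pi.add_apply, mul_add]
  map_smul' c v := by
    apply Subtype.ext
    funext a α
    change t.pow (L.slope α) * g.coord _ _ _ _ (c • v) α =
      c * (t.pow (L.slope α) * g.coord _ _ _ _ v α)
    rw [map_smul, Pi.smul_apply, smul_eq_mul, mul_left_comm]

lemma KaneyamaData.coord_act (g : L.KaneyamaData) (t : Torus N) {p q : F.Variety} (h : t • p = q)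
    (v : g.fiber p) (σ : F.MaxCone) (x : AffineChart N σ.1) (hx : σ.pt x = p)
    (hx' : σ.pt (t • x) = q) (α : L.Lift σ.1) :
    g.coord σ (t • x) q hx' (g.act t p q h v) α = t.pow (L.slope α) * g.coord σ x p hx v α := by
  change t.pow (L.slope α) * g.coord σ (t⁻¹ • t • x) p _ v α = _
  simp only [inv_smul_smul]

/-- The toric vector bundle `ℰ(L, g)`. -/
noncomputable def KaneyamaData.bundle (g : L.KaneyamaData) : ToricVectorBundle F where
  Fiber p := g.fiber p
  Frame σ := L.Lift σ.1
  triv σ x p h := LinearEquiv.ofBijective (g.coord σ x p h) (g.coord_bijective σ x p h)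
  transition_regular σ₁ σ₂ := ⟨g.transition σ₁ σ₂, fun z _ h₁ h₂ v => g.coord_transition z h₁ h₂ v⟩
  act := g.act
  act_one p v := by
    apply g.fiber_ext
    intro σ x hx
    funext α
    have e := g.coord_act 1 (one_smul _ p) v σ x hx (by rw [one_smul]; exact hx) α
    simpa only [one_smul, Torus.one_pow, one_mul] using e
  act_mul s t p q r hq hr v := by
    apply g.fiber_ext
    intro σ x hx
    obtain ⟨y, rfl⟩ : ∃ y, x = (s * t) • y := ⟨(s * t)⁻¹ • x, by rw [smul_inv_smul]⟩
    have hy : σ.pt y = p := by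
      have : (s * t) • σ.pt y = (s * t) • p := by
        rw [CompleteFan.MaxCone.smul_pt, hx, mul_smul, hq, hr]
      exact smul_left_cancel _ this
    have hy' : σ.pt (t • y) = q := by
      rw [← CompleteFan.MaxCone.smul_pt, hy, hq]
    have hy'' : σ.pt (s • t • y) = r := by
      rw [← CompleteFan.MaxCone.smul_pt, hy', hr]
    funext α
    rw [g.coord_act (s * t) _ v σ y hy]
    have e := g.coord_act s hr (g.act t p q hq v) σ (t • y) hy' hy'' α
    rw [g.coord_act t hq v σ y hy hy'] at e
    simp only [mul_smul]
    rw [e, Torus.mul_pow, mul_assoc]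
  act_regular σ := by
    refine ⟨Matrix.diagonal fun α => AddMonoidAlgebra.single (L.slope α, 0) 1, ?_⟩
    intro t x p q hp hq v
    funext α
    have e := g.coord_act t hq v σ x hp
      (by rw [← hq, ← hp, CompleteFan.MaxCone.smul_pt]) α
    have e' : evalTorusChart t x (AddMonoidAlgebra.single (L.slope α, 0) 1) =
        t.pow (L.slope α) := by
      rw [evalTorusChart, AddMonoidAlgebra.lift_single, one_smul]
      change t.pow (L.slope α) * charVal x 0 = _
      rw [charVal_zero, mul_one]
    rw [LinearEquiv.ofBijective_apply, e, Matrix.diagonal_map (map_zero _),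
      Matrix.vecMul_diagonal, e', mul_comm]
    rfl

end MultiSection

end MultiSections

end TropToric

/-!
# Toric vector bundles of tropical Lagrangian multi-sections

Both directions pass through one invariant of a multi-section `L`: for every full-dimensional cone
`σ`, the multiset of slopes of `φ` on the lifts of `σ` (`SameSlopes` compares two of them).

*The slopes over full-dimensional cones determine the slopes over all cones.* Attach to a point `x`
of `L` the linear function `germ x` that represents `φ` on the smallest cone containing `x`, and let
`germCount b G` be the total weight of the points over `b` with germ `G`. Over a small ball around
`b`, fixing the restriction of the germ to the smallest cone containing `b` cuts out an open and
closed subset of `L`, so the branched covering condition makes its trace constant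
(`germCount_eq_sum`). As the ball contains relative interior points of a full-dimensional cone,
the counts at `b` are sums of multiplicities of slopes over that cone.

*Combinatorial equivalence gives bijections of Kaneyama classes.* A morphism in the definition of
`≤` preserves germs and weights, hence counts; so combinatorially equivalent multi-sections have
slope-preserving bijections between their lifts. Kaneyama data are transported by reindexing; the
support condition on intersections is automatic because all cones of a connected multi-section share
a vertex (`IsConn.exists_vertex`). An equivalence of data with entries `h_{αβ}` gives the bundle
isomorphism with entries `h_{αβ} z^{m(α) - m(β)}` (`isomorphic_of_intertwining`).

*Isomorphic bundles come from combinatorially equivalent multi-sections.* At the torus-fixed point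
of `U(σ)` the torus acts on the fibre diagonally through the characters `m(α)`; an equivariant
isomorphism matches them (`sameSlopes_of_isomorphic`). If `L` and `L'` have the same slopes, then
identifying points of `L` with equal image and germ gives a multi-section `L.collapse` which lies
below `L` and, since the counts agree, below `L'` too (`collapse_leq_of_germCount`).
-/

/-! ### The cones of a fan -/

namespace TropToric

section FanGeometry

variable {V : Type v} [NormedAddCommGroup V] [NormedSpace ℝ V] {N : Submodule ℤ V}

lemma IsRationalPolyhedral.mem_iff {σ : PointedCone ℝ V} {S : Finset V}
    (hS : σ = PointedCone.hull ℝ (S : Set V)) {y : V} :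
    y ∈ σ ↔ ∃ c : S → ℝ, (∀ s, 0 ≤ c s) ∧ ∑ s, c s • (s : V) = y := by
  rw [hS]
  constructor
  · intro hy
    obtain ⟨f, -, hf⟩ := Submodule.mem_span_finset.1 hy
    refine ⟨fun s => (f s : ℝ), fun s => (f s).2, ?_⟩
    rw [← hf, ← Finset.sum_coe_sort S (fun a => f a • a)]
    rfl
  · rintro ⟨c, hc, rfl⟩
    refine Submodule.sum_mem _ fun s _ => ?_
    exact PointedCone.smul_mem _ (hc s) (PointedCone.subset_hull s.2)

/-- A strictly convex, finitely generated cone is closed. On nonnegative coefficient vectors `c` of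
sup norm one the combination `∑ c s • s` of nonzero generators does not vanish, hence stays away
from zero; so the bounded part of the cone is the image of a compact set of coefficients. -/
lemma IsRationalPolyhedral.isClosed {σ : PointedCone ℝ V} (hσ : IsRationalPolyhedral N σ)
    (hc : ∀ x ∈ σ, -x ∈ σ → x = 0) : IsClosed (σ : Set V) := by
  classical
  obtain ⟨S₀, -, hS₀⟩ := hσ
  obtain ⟨S, hS, h0⟩ : ∃ S : Finset V, σ = PointedCone.hull ℝ (S : Set V) ∧ (0 : V) ∉ S := by
    refine ⟨S₀.erase 0, ?_, by simp⟩
    rw [hS₀, Finset.coe_erase]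
    exact (Submodule.span_sdiff_singleton_zero (s := (S₀ : Set V))).symm
  have hmem : ∀ y, y ∈ σ ↔ _ := fun y => IsRationalPolyhedral.mem_iff hS (y := y)
  let g : (S → ℝ) →ₗ[ℝ] V :=
    { toFun := fun c => ∑ s, c s • (s : V)
      map_add' := fun c d => by simp [add_smul, Finset.sum_add_distrib]
      map_smul' := fun a c => by simp [Finset.smul_sum, smul_smul] }
  have hg : Continuous g := by
    change Continuous fun c : S → ℝ => ∑ s, c s • (s : V)
    fun_prop
  have hO : IsClosed {c : S → ℝ | ∀ s, 0 ≤ c s} := by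
    simp only [Set.ofPred_forall]
    exact isClosed_iInter fun s => isClosed_le continuous_const (continuous_apply s)
  have hK : IsCompact ({c : S → ℝ | ∀ s, 0 ≤ c s} ∩ Metric.sphere 0 1) :=
    (isCompact_sphere _ _).inter_left hO
  have hpos : ∀ c ∈ {c : S → ℝ | ∀ s, 0 ≤ c s} ∩ Metric.sphere 0 1, 0 < ‖g c‖ := by
    rintro c ⟨hc0, hc1⟩
    rw [norm_pos_iff]
    intro hgc
    have hne : c ≠ 0 := by
      rintro rfl
      simp at hc1
    obtain ⟨s, hs⟩ := Function.ne_iff.1 hne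
    have hsp : 0 < c s := lt_of_le_of_ne (hc0 s) (Ne.symm hs)
    have h1 : c s • (s : V) ∈ σ := (hmem _).2 ⟨Pi.single s (c s), fun t => by
      by_cases h : t = s
      · subst h; simpa using hc0 t
      · simp [h], by simp [Pi.single_apply, ite_smul]⟩
    have h2 : -(c s • (s : V)) ∈ σ := by
      refine (hmem _).2 ⟨Function.update c s 0, fun t => ?_, ?_⟩
      · by_cases h : t = s
        · subst h; simp
        · simpa [h] using hc0 t
      · have h3 : ∑ t, c t • (t : V) = 0 := hgc
        rw [← Finset.add_sum_erase _ _ (Finset.mem_univ s)] at h3 ⊢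
        rw [Function.update_self, zero_smul, zero_add, ← eq_neg_of_add_eq_zero_right h3]
        refine Finset.sum_congr rfl fun t ht => ?_
        rw [Function.update_of_ne (Finset.ne_of_mem_erase ht)]
    have h4 := hc _ h1 h2
    rcases smul_eq_zero.1 h4 with h | h
    · exact hsp.ne' h
    · exact h0 (h ▸ s.2)
  obtain ⟨ε, hε, hεle⟩ : ∃ ε > 0, ∀ c ∈ {c : S → ℝ | ∀ s, 0 ≤ c s} ∩ Metric.sphere 0 1,
      ε ≤ ‖g c‖ := by
    rcases Set.eq_empty_or_nonempty
      ({c : S → ℝ | ∀ s, 0 ≤ c s} ∩ Metric.sphere 0 1) with h | h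
    · exact ⟨1, one_pos, fun c hc => absurd hc (by rw [h]; exact Set.notMem_empty c)⟩
    · obtain ⟨c₀, hc₀, hmin⟩ := hK.exists_isMinOn h (hg.norm.continuousOn)
      exact ⟨‖g c₀‖, hpos _ hc₀, fun c hc => hmin hc⟩
  have hbound : ∀ c : S → ℝ, (∀ s, 0 ≤ c s) → ε * ‖c‖ ≤ ‖g c‖ := by
    intro c hc0
    rcases eq_or_ne c 0 with rfl | hne
    · simp
    have hn : 0 < ‖c‖ := norm_pos_iff.2 hne
    have := hεle (‖c‖⁻¹ • c) ⟨fun s => mul_nonneg (inv_nonneg.2 hn.le) (hc0 s), by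
      simp [norm_smul, hn.ne']⟩
    rw [map_smul, norm_smul, norm_inv, norm_norm, inv_mul_eq_div, le_div_iff₀ hn] at this
    exact this
  refine isClosed_of_closure_subset fun y hy => ?_
  have hC : IsCompact (g '' ({c : S → ℝ | ∀ s, 0 ≤ c s} ∩
      Metric.closedBall 0 ((‖y‖ + 1) / ε))) :=
    ((isCompact_closedBall _ _).inter_left hO).image hg
  have hsub : Metric.ball y 1 ∩ (σ : Set V) ⊆ g '' ({c : S → ℝ | ∀ s, 0 ≤ c s} ∩
      Metric.closedBall 0 ((‖y‖ + 1) / ε)) := by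
    rintro z ⟨hz1, hz2⟩
    obtain ⟨c, hc0, hcz⟩ := (hmem z).1 hz2
    refine ⟨c, ⟨hc0, ?_⟩, hcz⟩
    rw [mem_closedBall_zero_iff, le_div_iff₀ hε, mul_comm]
    refine (hbound c hc0).trans ?_
    have : g c = z := hcz
    rw [this]
    have h5 : ‖z - y‖ < 1 := by simpa [dist_eq_norm] using hz1
    have h6 : ‖z‖ ≤ ‖z - y‖ + ‖y‖ := by simpa using norm_add_le (z - y) y
    linarith
  have hy' : y ∈ closure (Metric.ball y 1 ∩ (σ : Set V)) :=
    (Metric.isOpen_ball).inter_closure ⟨Metric.mem_ball_self one_pos, hy⟩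
  obtain ⟨c, ⟨hc0, -⟩, hcy⟩ := hC.isClosed.closure_subset (closure_mono hsub hy')
  exact (hmem y).2 ⟨c, hc0, hcy⟩

variable (F : CompleteFan N)

/-- The smallest cone of the fan containing `y`; it is the cone with `y` in its relative
interior. -/
def CompleteFan.minCone (y : V) : PointedCone ℝ V := sInf {σ | σ ∈ F.cones ∧ y ∈ σ}

variable {F}

lemma CompleteFan.minCone_le {σ : PointedCone ℝ V} (hσ : σ ∈ F.cones) {y : V} (hy : y ∈ σ) :
    F.minCone y ≤ σ := sInf_le ⟨hσ, hy⟩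

lemma CompleteFan.mem_minCone (y : V) : y ∈ F.minCone y :=
  (Submodule.mem_sInf).2 fun _ h => h.2

lemma CompleteFan.inf_mem {σ τ : PointedCone ℝ V} (hσ : σ ∈ F.cones) (hτ : τ ∈ F.cones) :
    σ ⊓ τ ∈ F.cones :=
  F.face_mem σ hσ _ (F.inter_face σ hσ τ hτ)

lemma CompleteFan.minCone_mem (y : V) : F.minCone y ∈ F.cones := by
  have hfin : {σ | σ ∈ F.cones ∧ y ∈ σ}.Finite := F.finite.subset fun _ h => h.1
  have hne : {σ | σ ∈ F.cones ∧ y ∈ σ}.Nonempty := F.complete y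
  obtain ⟨τ, hτ, hmin⟩ := hfin.exists_minimal hne
  have : F.minCone y = τ := by
    refine le_antisymm (F.minCone_le hτ.1 hτ.2) (le_sInf fun σ hσ => ?_)
    exact (hmin (y := τ ⊓ σ) ⟨CompleteFan.inf_mem hτ.1 hσ.1, hτ.2, hσ.2⟩
      inf_le_left).trans inf_le_right
  rw [this]
  exact hτ.1

lemma CompleteFan.minCone_mono {x y : V} (h : x ∈ F.minCone y) : F.minCone x ≤ F.minCone y :=
  F.minCone_le (F.minCone_mem y) h

/-- A cone all of whose nonnegative integral functionals vanishing at `y` are trivial is the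
smallest cone containing `y`. -/
lemma CompleteFan.minCone_eq {σ : PointedCone ℝ V} (hσ : σ ∈ F.cones) {y : V} (hy : y ∈ σ)
    (h : ∀ m ∈ dualMonoid N σ, m.1 y = 0 → ∀ x ∈ σ, m.1 x = 0) : F.minCone y = σ := by
  refine le_antisymm (F.minCone_le hσ hy) fun x hx => ?_
  obtain ⟨m, h0, hm⟩ := F.inter_face σ hσ _ (F.minCone_mem y)
  have hy0 : m.1 y = 0 := ((hm y).1 ⟨hy, F.mem_minCone y⟩).2
  exact ((hm x).2 ⟨hx, h m h0 hy0 x hx⟩).2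

/-- The sum of generators of a cone is a point of its relative interior. -/
lemma CompleteFan.exists_minCone_eq {σ : PointedCone ℝ V} (hσ : σ ∈ F.cones) :
    ∃ y, F.minCone y = σ := by
  obtain ⟨S, -, hS⟩ := F.rational σ hσ
  have hSσ : ∀ s ∈ S, s ∈ σ := fun s hs => by
    rw [hS]
    exact PointedCone.subset_hull hs
  refine ⟨∑ s ∈ S, s, CompleteFan.minCone_eq hσ (Submodule.sum_mem _ hSσ) fun m hm h0 x hx => ?_⟩
  rw [map_sum, Finset.sum_eq_zero_iff_of_nonneg fun s hs => hm s (hSσ s hs)] at h0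
  obtain ⟨c, -, rfl⟩ := (IsRationalPolyhedral.mem_iff hS).1 hx
  rw [map_sum]
  exact Finset.sum_eq_zero fun s _ => by rw [map_smul, h0 s s.2, smul_zero]

lemma CompleteFan.isClosed {σ : PointedCone ℝ V} (hσ : σ ∈ F.cones) : IsClosed (σ : Set V) :=
  (F.rational σ hσ).isClosed (F.strictlyConvex σ hσ)

/-- Points close to `b` lie only in cones that contain `b`. -/
lemma CompleteFan.exists_ball (b : V) :
    ∃ ε > 0, ∀ y ∈ Metric.ball b ε, F.minCone b ≤ F.minCone y := by
  have hcl : IsClosed (⋃ σ ∈ {σ | σ ∈ F.cones ∧ b ∉ σ}, (σ : Set V)) :=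
    (F.finite.subset fun _ h => h.1).isClosed_biUnion fun σ hσ => F.isClosed hσ.1
  obtain ⟨ε, hε, hsub⟩ := Metric.isOpen_iff.1 hcl.isOpen_compl b (by simp)
  refine ⟨ε, hε, fun y hy => F.minCone_le (F.minCone_mem y) ?_⟩
  by_contra hb
  refine hsub hy ?_
  simp only [Set.mem_iUnion]
  exact ⟨_, ⟨F.minCone_mem y, hb⟩, F.mem_minCone y⟩

/-- Arbitrarily close to any point there are points in no cone of smaller dimension: finitely many
proper subspaces do not cover the space. -/
lemma CompleteFan.exists_generic (b : V) {ε : ℝ} (hε : 0 < ε) :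
    ∃ (a : V) (σ : F.MaxCone), a ∈ Metric.ball b ε ∧ F.minCone a = σ.1 := by
  classical
  let P : Finset (Submodule ℝ V) :=
    (F.finite.image fun σ : PointedCone ℝ V => Submodule.span ℝ (σ : Set V)).toFinset.filter (· ≠ ⊤)
  have hP : (⋃ p ∈ P, (p : Set V)) ≠ Set.univ :=
    Subspace.biUnion_ne_univ_of_top_notMem (by simp [P])
  obtain ⟨v, hv⟩ := (Set.ne_univ_iff_exists_notMem _).1 hP
  -- Two points of the line `b + ℝ v` in one proper subspace would put `v` in that subspace.
  have hfin : (⋃ p ∈ P, {t : ℝ | b + t • v ∈ p}).Finite := by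
    refine Set.Finite.biUnion P.finite_toSet fun p hp => Set.Subsingleton.finite ?_
    intro s hs t ht
    by_contra hst
    have h1 : (s - t) • v ∈ p := by
      have := p.sub_mem hs ht
      rwa [add_sub_add_left_eq_sub, ← sub_smul] at this
    have h2 : v ∈ p := (p.smul_mem_iff (sub_ne_zero.2 hst)).1 h1
    exact hv (Set.mem_biUnion hp h2)
  have hδ : 0 < ε / (‖v‖ + 1) := by positivity
  obtain ⟨t, ⟨ht0, ht1⟩, ht⟩ := ((Set.Ioo_infinite hδ).sdiff hfin).nonempty
  refine ⟨b + t • v, ⟨F.minCone (b + t • v), F.minCone_mem _, ?_⟩, ?_, rfl⟩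
  · by_contra hdim
    refine ht (Set.mem_biUnion (x := Submodule.span ℝ (F.minCone (b + t • v) : Set V)) ?_
      (Submodule.subset_span (F.mem_minCone _)))
    simp only [P, Finset.coe_filter, Set.Finite.mem_toFinset, Set.mem_ofPred_eq]
    refine ⟨⟨_, F.minCone_mem _, rfl⟩, fun htop => hdim ?_⟩
    rw [htop, finrank_top]
  · rw [mem_ball_iff_norm, add_sub_cancel_left, norm_smul, Real.norm_of_nonneg ht0.le]
    rw [lt_div_iff₀ (by positivity)] at ht1
    nlinarith [norm_nonneg v]

lemma continuous_dualLattice [FiniteDimensional ℝ V] (m : dualLattice N) : Continuous (m.1 : V → ℝ) :=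
  m.1.continuous_of_finiteDimensional

lemma CompleteFan.MaxCone.ext_functional [FiniteDimensional ℝ V] (σ : F.MaxCone)
    {m m' : dualLattice N} (h : ∀ x ∈ σ.1, m.1 x = m'.1 x) : m = m' := by
  apply Subtype.ext
  have htop : Submodule.span ℝ (σ.1 : Set V) = ⊤ := Submodule.eq_top_of_finrank_eq σ.2.2
  exact LinearMap.ext_on htop h

end FanGeometry

/-! ### Cones of a multi-section and their slopes -/

namespace ConeSystem

variable {X : Type u} [TopologicalSpace X] {C : ConeSystem X}

/-- The smallest cone containing `x`; it is the cone with `x` in its relative interior. -/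
def carrier (C : ConeSystem X) (x : X) : Set X := ⋂₀ {s | s ∈ C.cones ∧ x ∈ s}

lemma carrier_subset {s : Set X} (hs : s ∈ C.cones) {x : X} (hx : x ∈ s) : C.carrier x ⊆ s :=
  Set.sInter_subset_of_mem ⟨hs, hx⟩

lemma mem_carrier (x : X) : x ∈ C.carrier x := fun _ h => h.2

namespace IsConeComplex

variable (hC : C.IsConeComplex)
include hC

/-- Every cone containing `x` contains a cone with `x` in its relative interior, namely a minimal
one among those containing `x`; by the partition axiom it is the same for all of them. -/
lemma exists_relInt_subset {s : Set X} (hs : s ∈ C.cones) {x : X} (hx : x ∈ s) :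
    ∃ t ∈ C.cones, t ⊆ s ∧ x ∈ C.relInt t := by
  have hfin : {t | t ∈ C.cones ∧ x ∈ t ∧ t ⊆ s}.Finite := hC.finite.subset fun _ h => h.1
  obtain ⟨t, ⟨ht, hxt, hts⟩, hmin⟩ := hfin.exists_minimal ⟨s, hs, hx, subset_rfl⟩
  refine ⟨t, ht, hts, hxt, fun u hu hu0 hux => ?_⟩
  have hsub : face t u ⊆ t := fun _ h => h.1
  have hle := hmin (y := face t u)
    ⟨hC.face_mem t ht u hu hu0, ⟨hxt, hux⟩, hsub.trans hts⟩ hsub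
  ext y
  exact (hle y.2).2

lemma carrier_eq {t : Set X} (ht : t ∈ C.cones) {x : X} (hx : x ∈ C.relInt t) :
    C.carrier x = t := by
  refine (carrier_subset ht hx.1).antisymm (Set.subset_sInter ?_)
  rintro s ⟨hs, hxs⟩
  obtain ⟨t', ht', hts, hxt⟩ := hC.exists_relInt_subset hs hxs
  rwa [(hC.partition x).unique ⟨ht, hx⟩ ⟨ht', hxt⟩]

lemma carrier_mem_and (x : X) : C.carrier x ∈ C.cones ∧ x ∈ C.relInt (C.carrier x) := by
  obtain ⟨t, ⟨ht, hx⟩, -⟩ := hC.partition x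
  rw [hC.carrier_eq ht hx]
  exact ⟨ht, hx⟩

lemma carrier_mem (x : X) : C.carrier x ∈ C.cones := (hC.carrier_mem_and x).1

lemma mem_relInt_carrier (x : X) : x ∈ C.relInt (C.carrier x) := (hC.carrier_mem_and x).2

lemma mem_relInt_iff {s : Set X} (hs : s ∈ C.cones) {x : X} :
    x ∈ C.relInt s ↔ C.carrier x = s :=
  ⟨hC.carrier_eq hs, fun h => h ▸ hC.mem_relInt_carrier x⟩

end IsConeComplex

end ConeSystem

namespace MultiSection

variable {V : Type v} [NormedAddCommGroup V] [NormedSpace ℝ V] {N : Submodule ℤ V}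
  {F : CompleteFan N} {r : ℕ} {L : MultiSection.{u} F r}

lemma injOn {s : Set L.Dom} (hs : s ∈ L.sys.cones) : Set.InjOn L.π s :=
  Set.injOn_iff_injective.2 (L.isCovering.homeo s hs).injective

lemma continuous_π : Continuous L.π := L.isCovering.morphism.1

lemma exists_cone_image {s : Set L.Dom} (hs : s ∈ L.sys.cones) :
    ∃ σ ∈ F.cones, L.π '' s = (σ : Set V) :=
  L.isCovering.image_mem s hs

lemma carrier_mem (x : L.Dom) : L.sys.carrier x ∈ L.sys.cones := L.isConeComplex.carrier_mem x

lemma μ_eq_weight (x : L.Dom) : L.μ x = L.weight (L.sys.carrier x) := by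
  have hne : (L.sys.relInt (L.sys.carrier x)).Nonempty :=
    ⟨x, L.isConeComplex.mem_relInt_carrier x⟩
  rw [weight, dif_pos hne]
  exact L.isWeight.2 _ (carrier_mem x) _ (L.isConeComplex.mem_relInt_carrier x) _ hne.some_mem

section FiniteDim

variable [FiniteDimensional ℝ V]

lemma mem_lat_iff {s : Set L.Dom} (hs : s ∈ L.sys.cones) {v : C(s, ℝ)} :
    v ∈ L.sys.lat s ↔ ∃ m : dualLattice N, ∀ x : s, v x = m.1 (L.π x) := by
  rw [L.isCovering.lat_iff s hs]
  constructor
  · rintro ⟨u, ⟨m, hm⟩, hv⟩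
    exact ⟨m, fun x => by rw [hv, hm]⟩
  · rintro ⟨m, hm⟩
    exact ⟨⟨fun y => m.1 y, (continuous_dualLattice m).comp continuous_subtype_val⟩,
      ⟨m, fun _ => rfl⟩, hm⟩

/-- The projection maps the carrier of a point onto the smallest cone containing its image: a
functional cutting out a smaller face would pull back to a lattice function that vanishes at a
relative interior point. -/
lemma image_carrier (x : L.Dom) : L.π '' L.sys.carrier x = (F.minCone (L.π x) : Set V) := by
  obtain ⟨σ, hσ, he⟩ := exists_cone_image (carrier_mem x)
  rw [he]
  have hx : L.π x ∈ σ := he.subset ⟨x, ConeSystem.mem_carrier x, rfl⟩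
  rw [CompleteFan.minCone_eq hσ hx ?_]
  intro m hm h0 y hy
  obtain ⟨y, hys, rfl⟩ := he.superset hy
  have hcont : Continuous fun z : L.sys.carrier x => m.1 (L.π z) :=
    (continuous_dualLattice m).comp (continuous_π.comp continuous_subtype_val)
  have := (L.isConeComplex.mem_relInt_carrier x).2 ⟨_, hcont⟩
    ((mem_lat_iff (carrier_mem x)).2 ⟨m, fun _ => rfl⟩)
    (fun z => hm _ (he.subset ⟨z, z.2, rfl⟩)) h0
  exact DFunLike.congr_fun this ⟨y, hys⟩

lemma exists_mem_carrier {x : L.Dom} {y : V} (h : y ∈ F.minCone (L.π x)) :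
    ∃ x' ∈ L.sys.carrier x, L.π x' = y :=
  (image_carrier x).superset h

lemma π_mem_minCone {x x' : L.Dom} (h : x' ∈ L.sys.carrier x) : L.π x' ∈ F.minCone (L.π x) :=
  (image_carrier x).subset ⟨x', h, rfl⟩

lemma carrier_eq_of_image {s : Set L.Dom} (hs : s ∈ L.sys.cones) {x : L.Dom} (hx : x ∈ s)
    (h : L.π '' s = (F.minCone (L.π x) : Set V)) : L.sys.carrier x = s := by
  refine (ConeSystem.carrier_subset hs hx).antisymm fun y hy => ?_
  obtain ⟨y', hy', he⟩ := exists_mem_carrier (h.subset ⟨y, hy, rfl⟩)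
  rwa [← injOn hs (ConeSystem.carrier_subset hs hx hy') hy he]

lemma carrier_eq_of_mem {x x' : L.Dom} (h : x' ∈ L.sys.carrier x)
    (he : F.minCone (L.π x') = F.minCone (L.π x)) : L.sys.carrier x' = L.sys.carrier x :=
  carrier_eq_of_image (carrier_mem x) h (by rw [he, image_carrier])

/-- The points over `b` correspond to the cones over the smallest cone containing `b`. -/
lemma bijOn_carrier (b : V) : Set.BijOn L.sys.carrier {x | L.π x = b}
    {s | s ∈ L.sys.cones ∧ L.π '' s = (F.minCone b : Set V)} := by
  refine ⟨?_, ?_, ?_⟩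
  · rintro x rfl
    exact ⟨carrier_mem x, image_carrier x⟩
  · intro x hx y hy h
    refine injOn (carrier_mem x) (ConeSystem.mem_carrier x) ?_ (hx.trans hy.symm)
    rw [h]
    exact ConeSystem.mem_carrier y
  · rintro s ⟨hs, he⟩
    obtain ⟨x, hx, rfl⟩ := he.superset (F.mem_minCone b)
    exact ⟨x, rfl, carrier_eq_of_image hs hx he⟩

lemma finite_fiber (L : MultiSection.{u} F r) (b : V) : {x | L.π x = b}.Finite :=
  (bijOn_carrier b).finite_iff_finite.2 (L.isConeComplex.finite.subset fun _ h => h.1)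

/-- The linear function representing `φ` near the relative interior of the carrier of `x`,
recorded as a function on the whole space that vanishes off the smallest cone containing `π x`;
this makes the functions for different points, and for different multi-sections, comparable. -/
noncomputable def germ (L : MultiSection.{u} F r) (x : L.Dom) : V → ℝ :=
  Set.indicator (F.minCone (L.π x) : Set V) (L.exists_slope (carrier_mem x)).choose.1

lemma germ_eq {s : Set L.Dom} (hs : s ∈ L.sys.cones) {x : L.Dom} (hx : x ∈ s)
    {m : dualLattice N} (hm : ∀ y ∈ s, L.φ y = m.1 (L.π y)) :
    L.germ x = Set.indicator (F.minCone (L.π x) : Set V) m.1 := by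
  refine Set.indicator_congr fun v hv => ?_
  obtain ⟨y, hy, rfl⟩ := exists_mem_carrier hv
  rw [← hm y (ConeSystem.carrier_subset hs hx hy)]
  exact ((L.exists_slope (carrier_mem x)).choose_spec y hy).symm

lemma germ_apply {x y : L.Dom} (h : y ∈ L.sys.carrier x) : L.germ x (L.π y) = L.φ y := by
  rw [germ, Set.indicator_of_mem (show L.π y ∈ (F.minCone (L.π x) : Set V) from π_mem_minCone h)]
  exact ((L.exists_slope (carrier_mem x)).choose_spec y h).symm

lemma germ_restrict {s : Set L.Dom} (hs : s ∈ L.sys.cones) {x x' : L.Dom} (hx : x ∈ s)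
    (hx' : x' ∈ s) (h : F.minCone (L.π x') ≤ F.minCone (L.π x)) :
    L.germ x' = Set.indicator (F.minCone (L.π x') : Set V) (L.germ x) := by
  obtain ⟨m, hm⟩ := L.exists_slope hs
  have h' : (F.minCone (L.π x') : Set V) ⊆ F.minCone (L.π x) := h
  rw [germ_eq hs hx hm, germ_eq hs hx' hm, Set.indicator_indicator,
    Set.inter_eq_left.2 h']

lemma germ_of_mem_carrier {x x' : L.Dom} (h : x' ∈ L.sys.carrier x) :
    L.germ x' = Set.indicator (F.minCone (L.π x') : Set V) (L.germ x) :=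
  germ_restrict (carrier_mem x) (ConeSystem.mem_carrier x) h
    (CompleteFan.minCone_mono (π_mem_minCone h))

lemma germ_eq_germ {L' : MultiSection.{u} F r} {x x' : L.Dom} {y y' : L'.Dom}
    (hg : L.germ x = L'.germ y) (hx : x' ∈ L.sys.carrier x) (hy : y' ∈ L'.sys.carrier y)
    (h : L.π x' = L'.π y') : L.germ x' = L'.germ y' := by
  rw [germ_of_mem_carrier hx, germ_of_mem_carrier hy, hg, h]

/-! ### Counting points with a given slope -/

/-- The trace of the weight over a connected open set is constant for every union of connected
components of the preimage. -/
lemma trace_eq_of_components {U : Set V} (hU : IsOpen U) (hU' : IsConnected U) {A : Set L.Dom}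
    (hA : A ⊆ L.π ⁻¹' U)
    (hA' : ∀ x ∈ A, connectedComponentIn (L.π ⁻¹' U) x ⊆ A) {a b : V} (ha : a ∈ U) (hb : b ∈ U) :
    ConeSystem.trace L.π L.μ A a = ConeSystem.trace L.π L.μ A b := by
  let c : L.Dom → Set L.Dom := connectedComponentIn (L.π ⁻¹' U)
  have hfib : ∀ (B : Set L.Dom) (y : V), (B ∩ L.π ⁻¹' {y}).Finite := fun B y =>
    (L.finite_fiber y).subset fun _ h => h.2
  have hconst : ∀ x ∈ A, ∀ y ∈ U, ∀ z ∈ U, ConeSystem.trace L.π L.μ (c x) y =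
      ConeSystem.trace L.π L.μ (c x) z := fun x hx y hy z hz =>
    L.isCovering.trace_const U hU hU' x (hA hx) y hy z hz
  -- Every component has a point over each `y`, since its trace is a positive constant.
  have hmeet : ∀ x ∈ A, ∀ y ∈ U, ∃ x' ∈ A ∩ L.π ⁻¹' {y}, c x' = c x := by
    intro x hx y hy
    have hpos : ConeSystem.trace L.π L.μ (c x) (L.π x) ≠ 0 := by
      rw [ConeSystem.trace, finsum_mem_eq_finite_toFinset_sum _ (hfib _ _)]
      refine ((L.isWeight.1 x).trans_le (Finset.single_le_sum (f := L.μ) (fun _ _ => Nat.zero_le _)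
        ?_)).ne'
      simp only [Set.Finite.mem_toFinset]
      exact ⟨mem_connectedComponentIn (hA hx), rfl⟩
    rw [hconst x hx _ (hA hx) y hy] at hpos
    obtain ⟨x', hx', -⟩ := exists_ne_zero_of_finsum_mem_ne_zero hpos
    exact ⟨x', ⟨hA' x hx hx'.1, hx'.2⟩, (connectedComponentIn_eq hx'.1).symm⟩
  have hsum : ∀ y ∈ U, ConeSystem.trace L.π L.μ A y =
      ∑ᶠ K ∈ c '' A, ConeSystem.trace L.π L.μ K y := by
    intro y hy
    have himg : c '' A = c '' (A ∩ L.π ⁻¹' {y}) := by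
      refine (Set.image_subset_iff.2 fun x hx => ?_).antisymm (Set.image_mono fun _ h => h.1)
      obtain ⟨x', hx', he⟩ := hmeet x hx y hy
      exact ⟨x', hx', he⟩
    have hunion : A ∩ L.π ⁻¹' {y} = ⋃ K ∈ c '' A, K ∩ L.π ⁻¹' {y} := by
      ext x
      simp only [Set.mem_iUnion, Set.mem_image, exists_prop]
      constructor
      · rintro ⟨hx, hy⟩
        exact ⟨_, ⟨x, hx, rfl⟩, mem_connectedComponentIn (hA hx), hy⟩
      · rintro ⟨_, ⟨x', hx', rfl⟩, hx, hy⟩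
        exact ⟨hA' x' hx' hx, hy⟩
    rw [ConeSystem.trace, hunion, finsum_mem_biUnion]
    · rfl
    · rintro _ ⟨x, hx, rfl⟩ _ ⟨x', hx', rfl⟩ hne
      refine Set.disjoint_left.2 fun z hz hz' => hne ?_
      exact (connectedComponentIn_eq hz.1).trans (connectedComponentIn_eq hz'.1).symm
    · rw [himg]
      exact (hfib A y).image c
    · exact fun _ _ => hfib _ y
  rw [hsum a ha, hsum b hb]
  refine finsum_mem_congr rfl ?_
  rintro _ ⟨x, hx, rfl⟩
  exact hconst x hx a ha b hb

/-- The total weight of the points over `b` at which `φ` has the slope recorded by `G`. -/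
noncomputable def germCount (L : MultiSection.{u} F r) (b : V) (G : V → ℝ) : ℕ :=
  ∑ᶠ x ∈ {x | L.π x = b ∧ L.germ x = G}, L.μ x

lemma finite_germ_fiber (b : V) (P : L.Dom → Prop) : {x | L.π x = b ∧ P x}.Finite :=
  (L.finite_fiber b).subset fun _ h => h.1

omit [FiniteDimensional ℝ V] in
lemma exists_of_germCount_ne_zero {b : V} {G : V → ℝ} (h : L.germCount b G ≠ 0) :
    ∃ x, L.π x = b ∧ L.germ x = G := by
  obtain ⟨x, hx, -⟩ := exists_ne_zero_of_finsum_mem_ne_zero h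
  exact ⟨x, hx⟩

lemma germCount_ne_zero (x : L.Dom) : L.germCount (L.π x) (L.germ x) ≠ 0 := by
  rw [germCount, finsum_mem_eq_finite_toFinset_sum _ (finite_germ_fiber _ _)]
  refine ((L.isWeight.1 x).trans_le (Finset.single_le_sum (f := L.μ) (fun _ _ => Nat.zero_le _)
    ?_)).ne'
  simp

/-- The counts depend only on the cone of the fan whose relative interior contains the point. -/
lemma germCount_congr {b b' : V} (h : F.minCone b = F.minCone b') (G : V → ℝ) :
    L.germCount b G = L.germCount b' G := by
  have key : ∀ x, L.π x = b → ∃ x', x' ∈ L.sys.carrier x ∧ L.π x' = b' := by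
    rintro x rfl
    exact exists_mem_carrier (by rw [h]; exact F.mem_minCone b')
  choose! e he heb using key
  refine finsum_mem_eq_of_bijOn e ⟨?_, ?_, ?_⟩ ?_
  · rintro x ⟨hx, rfl⟩
    refine ⟨heb x hx, ?_⟩
    have h1 : F.minCone (L.π (e x)) = F.minCone (L.π x) := by rw [heb x hx, hx, h]
    rw [germ_of_mem_carrier (he x hx), h1, germ, Set.indicator_indicator, Set.inter_self]
  · rintro x ⟨hx, -⟩ y ⟨hy, -⟩ hxy
    have hc : ∀ z, L.π z = b → L.sys.carrier (e z) = L.sys.carrier z := fun z hz =>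
      carrier_eq_of_mem (he z hz) (by rw [heb z hz, hz, h])
    refine (bijOn_carrier b).injOn hx hy ?_
    rw [← hc x hx, ← hc y hy, hxy]
  · rintro y ⟨hy, hG⟩
    obtain ⟨x, hx, hxb⟩ := exists_mem_carrier (x := y) (y := b)
      (by rw [hy, ← h]; exact F.mem_minCone b)
    have hmin : F.minCone (L.π x) = F.minCone (L.π y) := by rw [hy, hxb, h]
    have hcar := carrier_eq_of_mem hx hmin
    refine ⟨x, ⟨hxb, ?_⟩, ?_⟩
    · rw [germ_of_mem_carrier hx, hmin, ← hG, germ, Set.indicator_indicator, Set.inter_self]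
    · refine injOn (carrier_mem x) (he x hxb) ?_ ((heb x hxb).trans hy.symm)
      rw [hcar]
      exact ConeSystem.mem_carrier y
  · rintro x ⟨hx, -⟩
    rw [μ_eq_weight, μ_eq_weight, carrier_eq_of_mem (he x hx) (by rw [heb x hx, hx, h])]

/-- The count at `b` is determined by the counts at a nearby point `a`: over a small ball around
`b`, prescribing the restriction of the slope to the smallest cone containing `b` cuts out an open
and closed part of `L`, on which the trace of the weight is constant. -/
lemma germCount_eq_sum {b : V} {ε : ℝ} (hε : 0 < ε)
    (hball : ∀ y ∈ Metric.ball b ε, F.minCone b ≤ F.minCone y) {a : V} (ha : a ∈ Metric.ball b ε)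
    (G : V → ℝ) :
    L.germCount b G = ∑ᶠ x ∈ {x | L.π x = a ∧
      Set.indicator (F.minCone b : Set V) (L.germ x) = G}, L.μ x := by
  let A : Set L.Dom := {x | L.π x ∈ Metric.ball b ε ∧
    Set.indicator (F.minCone b : Set V) (L.germ x) = G}
  let κ : Set (Set L.Dom) := {s | s ∈ L.sys.cones ∧ ∀ x ∈ s, L.π x ∈ Metric.ball b ε → x ∈ A}
  let κ' : Set (Set L.Dom) := {s | s ∈ L.sys.cones ∧ ∀ x ∈ s, L.π x ∈ Metric.ball b ε → x ∉ A}
  have hcl : ∀ κ ⊆ L.sys.cones, IsClosed (⋃₀ κ) := fun κ h => by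
    rw [Set.sUnion_eq_biUnion]
    exact (L.isConeComplex.finite.subset h).isClosed_biUnion
      fun s hs => L.isConeComplex.closed s (h hs)
  -- On each cone the restricted slope is constant.
  have hdich : ∀ s ∈ L.sys.cones, s ∈ κ ∨ s ∈ κ' := by
    intro s hs
    obtain ⟨m, hm⟩ := L.exists_slope hs
    have key : ∀ x ∈ s, L.π x ∈ Metric.ball b ε →
        Set.indicator (F.minCone b : Set V) (L.germ x) =
          Set.indicator (F.minCone b : Set V) m.1 := by
      intro x hx hxb
      have h' : (F.minCone b : Set V) ⊆ F.minCone (L.π x) := hball _ hxb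
      rw [germ_eq hs hx hm, Set.indicator_indicator, Set.inter_eq_left.2 h']
    by_cases hG : Set.indicator (F.minCone b : Set V) m.1 = G
    · exact .inl ⟨hs, fun x hx hxb => ⟨hxb, (key x hx hxb).trans hG⟩⟩
    · exact .inr ⟨hs, fun x hx hxb hxA => hG ((key x hx hxb).symm.trans hxA.2)⟩
  have hsat : ∀ x ∈ A, connectedComponentIn (L.π ⁻¹' Metric.ball b ε) x ⊆ A := by
    intro x hx y hy
    have hsub := connectedComponentIn_subset (L.π ⁻¹' Metric.ball b ε) x
    by_contra hyA
    have hcov : ∀ z, z ∈ ⋃₀ κ ∪ ⋃₀ κ' := fun z =>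
      (hdich _ (carrier_mem z)).imp (fun h => ⟨_, h, ConeSystem.mem_carrier z⟩)
        (fun h => ⟨_, h, ConeSystem.mem_carrier z⟩)
    have hxc := mem_connectedComponentIn (F := L.π ⁻¹' Metric.ball b ε) hx.1
    obtain ⟨z, hz, ⟨s, hs, hzs⟩, ⟨s', hs', hzs'⟩⟩ := isPreconnected_closed_iff.1
      isPreconnected_connectedComponentIn _ _ (hcl κ fun _ h => h.1) (hcl κ' fun _ h => h.1)
      (fun z (_ : z ∈ connectedComponentIn (L.π ⁻¹' Metric.ball b ε) x) => hcov z)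
      ⟨x, hxc, (hcov x).resolve_right fun ⟨s, hs, hxs⟩ => hs.2 x hxs hx.1 hx⟩
      ⟨y, hy, (hcov y).resolve_left fun ⟨s, hs, hys⟩ => hyA (hs.2 y hys (hsub hy))⟩
    exact hs'.2 z hzs' (hsub hz) (hs.2 z hzs (hsub hz))
  have key := trace_eq_of_components (L := L) Metric.isOpen_ball
    (Metric.isConnected_ball hε) (A := A) (fun _ h => h.1) hsat (Metric.mem_ball_self hε) ha
  have hset : ∀ y ∈ Metric.ball b ε, A ∩ L.π ⁻¹' {y} = {x | L.π x = y ∧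
      Set.indicator (F.minCone b : Set V) (L.germ x) = G} := by
    intro y hy
    ext x
    constructor
    · rintro ⟨⟨-, h⟩, h'⟩
      exact ⟨h', h⟩
    · rintro ⟨rfl, h⟩
      exact ⟨⟨hy, h⟩, rfl⟩
  rw [ConeSystem.trace, ConeSystem.trace, hset _ ha, hset _ (Metric.mem_ball_self hε)] at key
  rw [← key, germCount]
  refine finsum_mem_congr (Set.ext fun x => and_congr_right fun hx => ?_) fun _ _ => rfl
  rw [germ, ← hx, Set.indicator_indicator, Set.inter_self]

end FiniteDim

end MultiSection

/-! ### Slopes over the full-dimensional cones determine all counts -/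

lemma exists_equiv_of_card_fiber {α β M : Type*} [Finite α] [Finite β] {f : α → M} {g : β → M}
    (h : ∀ m, Nat.card {a // f a = m} = Nat.card {b // g b = m}) :
    ∃ e : α ≃ β, ∀ a, g (e a) = f a :=
  ⟨Equiv.ofFiberEquiv fun m => (Finite.card_eq.1 (h m)).some, Equiv.ofFiberEquiv_map _⟩

namespace MultiSection

variable {V : Type v} [NormedAddCommGroup V] [NormedSpace ℝ V] {N : Submodule ℤ V}
  {F : CompleteFan N} {r : ℕ} {L L' : MultiSection.{u} F r}

/-- Over every full-dimensional cone the two multi-sections have the same multiset of slopes. -/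
def SameSlopes (L L' : MultiSection.{u} F r) : Prop :=
  ∀ σ : F.MaxCone, ∃ e : L.Lift σ.1 ≃ L'.Lift σ.1, ∀ α, L'.slope (e α) = L.slope α

variable [FiniteDimensional ℝ V]

lemma card_slope_eq (σ : F.MaxCone) {a : V} (ha : F.minCone a = σ.1) (m : dualLattice N) :
    Nat.card {α : L.Lift σ.1 // L.slope α = m} =
      L.germCount a (Set.indicator (σ.1 : Set V) m.1) := by
  let S : Set L.Dom := {x | L.π x = a ∧ L.germ x = Set.indicator (σ.1 : Set V) m.1}
  let B := {s : Set L.Dom // s ∈ L.sys.cones ∧ L.π '' s = σ.1}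
  let q : B → Prop := fun s => (L.exists_slope s.2.1).choose = m
  have hS : S.Finite := finite_germ_fiber a _
  have : Fintype S := hS.fintype
  have hspec : ∀ (s : B) {x : L.Dom}, L.π x = a → x ∈ s.1 →
      (L.germ x = Set.indicator (σ.1 : Set V) m.1 ↔ q s) := by
    rintro s x rfl hxs
    have hgerm := germ_eq s.2.1 hxs (L.exists_slope s.2.1).choose_spec
    rw [ha] at hgerm
    rw [hgerm]
    refine ⟨fun h => σ.ext_functional fun v hv => ?_, fun h => by rw [h]⟩
    have hv' : v ∈ (σ.1 : Set V) := hv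
    have := congrFun h v
    rwa [Set.indicator_of_mem hv', Set.indicator_of_mem hv'] at this
  let f : S → {s : B // q s} := fun x =>
    ⟨⟨L.sys.carrier x.1, carrier_mem x.1, by rw [image_carrier, x.2.1, ha]⟩,
      (hspec _ x.2.1 (ConeSystem.mem_carrier x.1)).1 x.2.2⟩
  have hf : Function.Bijective f := by
    constructor
    · intro x y h
      exact Subtype.ext ((bijOn_carrier a).injOn x.2.1 y.2.1
        (congrArg (fun z : {s : B // q s} => z.1.1) h))
    · rintro ⟨s, hs⟩
      obtain ⟨x, hx, hxs⟩ := (bijOn_carrier (L := L) a).surjOn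
        (show s.1 ∈ _ from ⟨s.2.1, by rw [ha]; exact s.2.2⟩)
      have hx' : x ∈ s.1 := hxs ▸ ConeSystem.mem_carrier x
      exact ⟨⟨x, hx, (hspec s hx hx').2 hs⟩, Subtype.ext (Subtype.ext hxs)⟩
  let e₁ : {α : L.Lift σ.1 // L.slope α = m} ≃ Σ s : {s : B // q s}, Fin (L.weight s.1.1) :=
    Equiv.subtypeSigmaEquiv (fun s : B => Fin (L.weight s.1)) q
  let e₂ : (Σ x : S, Fin (L.μ x.1)) ≃ Σ s : {s : B // q s}, Fin (L.weight s.1.1) :=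
    Equiv.sigmaCongr (Equiv.ofBijective f hf) fun x => finCongr (μ_eq_weight x.1)
  rw [Nat.card_congr e₁, ← Nat.card_congr e₂, Nat.card_sigma, germCount]
  simp only [Nat.card_eq_fintype_card, Fintype.card_fin]
  rw [← finsum_eq_sum_of_fintype, finsum_set_coe_eq_finsum_mem]

lemma sameSlopes_of_germCount (h : ∀ b G, L.germCount b G = L'.germCount b G) :
    L.SameSlopes L' := by
  intro σ
  obtain ⟨a, ha⟩ := F.exists_minCone_eq σ.2.1
  refine exists_equiv_of_card_fiber fun m => ?_
  rw [card_slope_eq σ ha, card_slope_eq σ ha, h]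

lemma SameSlopes.germCount_eq_of_maxCone (h : L.SameSlopes L') (σ : F.MaxCone) {a : V}
    (ha : F.minCone a = σ.1) (G : V → ℝ) : L.germCount a G = L'.germCount a G := by
  have key : ∀ m : dualLattice N, L.germCount a (Set.indicator (σ.1 : Set V) m.1) =
      L'.germCount a (Set.indicator (σ.1 : Set V) m.1) := by
    intro m
    obtain ⟨e, he⟩ := h σ
    rw [← card_slope_eq σ ha, ← card_slope_eq σ ha]
    exact Nat.card_congr (e.subtypeEquiv fun α => by rw [he])
  have hG : ∀ {L : MultiSection.{u} F r}, L.germCount a G ≠ 0 →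
      ∃ m : dualLattice N, G = Set.indicator (σ.1 : Set V) m.1 := by
    intro L h
    obtain ⟨x, rfl, rfl⟩ := exists_of_germCount_ne_zero h
    exact ⟨_, by rw [← ha]; rfl⟩
  by_cases h1 : L.germCount a G = 0
  · by_cases h2 : L'.germCount a G = 0
    · rw [h1, h2]
    · obtain ⟨m, rfl⟩ := hG h2
      exact key m
  · obtain ⟨m, rfl⟩ := hG h1
    exact key m

lemma sum_eq_sum_germCount (L : MultiSection.{u} F r) (a : V) (P : (V → ℝ) → Prop) :
    ∑ᶠ x ∈ {x | L.π x = a ∧ P (L.germ x)}, L.μ x =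
      ∑ᶠ G ∈ {G | P G ∧ L.germCount a G ≠ 0}, L.germCount a G := by
  have hunion : {x | L.π x = a ∧ P (L.germ x)} =
      ⋃ G ∈ {G | P G ∧ L.germCount a G ≠ 0}, {x | L.π x = a ∧ L.germ x = G} := by
    ext x
    simp only [Set.mem_iUnion, exists_prop]
    constructor
    · rintro ⟨rfl, h⟩
      exact ⟨L.germ x, ⟨h, germCount_ne_zero x⟩, rfl, rfl⟩
    · rintro ⟨_, ⟨h, -⟩, hx, rfl⟩
      exact ⟨hx, h⟩
  rw [hunion, finsum_mem_biUnion]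
  · rfl
  · rintro G - G' - hne
    exact Set.disjoint_left.2 fun x hx hx' => hne (hx.2.symm.trans hx'.2)
  · refine ((L.finite_fiber a).image L.germ).subset ?_
    rintro G ⟨-, h⟩
    exact exists_of_germCount_ne_zero h
  · exact fun G _ => finite_germ_fiber a _

/-- Every point is approached by relative interior points of full-dimensional cones, so the slopes
there determine the counts everywhere. -/
lemma SameSlopes.germCount_eq (h : L.SameSlopes L') (b : V) (G : V → ℝ) :
    L.germCount b G = L'.germCount b G := by
  obtain ⟨ε, hε, hball⟩ := F.exists_ball b
  obtain ⟨a, σ, ha, hσ⟩ := F.exists_generic b hε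
  have key : ∀ G, L.germCount a G = L'.germCount a G := h.germCount_eq_of_maxCone σ hσ
  rw [germCount_eq_sum hε hball ha, germCount_eq_sum hε hball ha,
    sum_eq_sum_germCount L a fun g => Set.indicator (F.minCone b : Set V) g = G,
    sum_eq_sum_germCount L' a fun g => Set.indicator (F.minCone b : Set V) g = G]
  simp only [key]

lemma Leq.germCount_eq (h : L.Leq L') (b : V) (G : V → ℝ) :
    L.germCount b G = L'.germCount b G := by
  obtain ⟨f, -, hf, hπ, hμ, hφ⟩ := h
  have hgerm : ∀ x, L.germ (f x) = L'.germ x := by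
    intro x
    obtain ⟨τ, hτ, hmaps, -⟩ := hf.2 _ (carrier_mem x)
    obtain ⟨m, hm⟩ := L.exists_slope hτ
    rw [germ_eq hτ (hmaps (ConeSystem.mem_carrier x)) hm, hπ,
      germ_eq (carrier_mem x) (ConeSystem.mem_carrier x) (m := m)
        fun y hy => by rw [← hφ, hm _ (hmaps hy), hπ]]
  have hunion : {x | L'.π x = b ∧ L'.germ x = G} =
      ⋃ y ∈ {y | L.π y = b ∧ L.germ y = G}, Set.univ ∩ f ⁻¹' {y} := by
    ext x
    simp [hπ, hgerm]
  symm
  rw [germCount, hunion, finsum_mem_biUnion]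
  · exact finsum_mem_congr rfl fun y _ => hμ y
  · rintro y - y' - hne
    exact Set.disjoint_left.2 fun x hx hx' => hne (hx.2.symm.trans hx'.2)
  · exact finite_germ_fiber b _
  · rintro y -
    refine (L'.finite_fiber (L.π y)).subset ?_
    rintro x ⟨-, rfl⟩
    exact (hπ x).symm

lemma CombEquiv.sameSlopes (h : L.CombEquiv L') : L.SameSlopes L' := by
  refine sameSlopes_of_germCount fun b G => ?_
  induction h with
  | refl => rfl
  | tail _ h ih =>
    obtain ⟨-, -, K, h1, h2⟩ := h
    rw [ih, ← h1.germCount_eq, h2.germCount_eq]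

omit [FiniteDimensional ℝ V] in
/-- All cones of a connected multi-section have a common vertex: every cone has exactly one point
over the origin, and the unions of the cones with and without a given such point are disjoint
closed sets. -/
lemma IsConn.exists_vertex (h : L.IsConn) : ∃ v, ∀ s ∈ L.sys.cones, v ∈ s := by
  have : ConnectedSpace L.Dom := h
  have hzero : ∀ s ∈ L.sys.cones, ∃ v ∈ s, L.π v = 0 := by
    intro s hs
    obtain ⟨σ, -, he⟩ := exists_cone_image hs
    exact he.superset σ.zero_mem
  obtain ⟨v, hv⟩ := L.isCovering.surjective 0
  have hcl : ∀ κ ⊆ L.sys.cones, IsClosed (⋃₀ κ) := fun κ h => by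
    rw [Set.sUnion_eq_biUnion]
    exact (L.isConeComplex.finite.subset h).isClosed_biUnion
      fun s hs => L.isConeComplex.closed s (h hs)
  refine ⟨v, fun s hs => ?_⟩
  by_contra hvs
  obtain ⟨w, hw, -⟩ := hzero s hs
  obtain ⟨x, -, ⟨t, ht, hxt⟩, ⟨t', ht', hxt'⟩⟩ := isPreconnected_closed_iff.1
    (isPreconnected_univ (α := L.Dom)) (⋃₀ {t | t ∈ L.sys.cones ∧ v ∈ t})
    (⋃₀ {t | t ∈ L.sys.cones ∧ v ∉ t}) (hcl _ fun _ h => h.1) (hcl _ fun _ h => h.1)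
    (fun x _ => (em (v ∈ L.sys.carrier x)).imp
      (fun h => ⟨_, ⟨carrier_mem x, h⟩, ConeSystem.mem_carrier x⟩)
      (fun h => ⟨_, ⟨carrier_mem x, h⟩, ConeSystem.mem_carrier x⟩))
    ⟨v, trivial, _, ⟨carrier_mem v, ConeSystem.mem_carrier v⟩, ConeSystem.mem_carrier v⟩
    ⟨w, trivial, s, ⟨hs, hvs⟩, hw⟩
  obtain ⟨v', hv', hv0⟩ := hzero _ (carrier_mem x)
  rw [injOn ht.1 (ConeSystem.carrier_subset ht.1 hxt hv') ht.2 (hv0.trans hv.symm)] at hv'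
  exact ht'.2 (ConeSystem.carrier_subset ht'.1 hxt' hv')

end MultiSection

/-! ### Transport of Kaneyama data and isomorphisms of bundles -/

namespace MultiSection

variable {V : Type v} [NormedAddCommGroup V] [NormedSpace ℝ V] {N : Submodule ℤ V}
  {F : CompleteFan N} {r : ℕ} {L L' : MultiSection.{u} F r}

/-- Transport of Kaneyama data along slope-preserving bijections of the lifts. Connectedness of the
target guarantees that any two of its cones meet. -/
noncomputable def KaneyamaData.reindex (hL' : L'.IsConn)
    (e : ∀ σ : F.MaxCone, L.Lift σ.1 ≃ L'.Lift σ.1)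
    (he : ∀ σ α, L'.slope (e σ α) = L.slope α) (g : L.KaneyamaData) : L'.KaneyamaData where
  g σ₁ σ₂ := (g.g σ₁ σ₂).submatrix (e σ₁).symm (e σ₂).symm
  g_self σ := by rw [g.g_self, Matrix.submatrix_one_equiv]
  g_supp σ₁ σ₂ α β h := by
    obtain ⟨v, hv⟩ := hL'.exists_vertex
    refine ⟨⟨v, hv _ α.1.2.1, hv _ β.1.2.1⟩, ?_⟩
    have := (g.g_supp σ₁ σ₂ _ _ h).2
    rwa [← he, ← he, Equiv.apply_symm_apply, Equiv.apply_symm_apply] at this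
  g_mul σ₁ σ₂ σ₃ := by rw [Matrix.submatrix_mul_equiv, g.g_mul]

/-- Transport of Kaneyama data is a bijection. -/
noncomputable def KaneyamaData.reindexEquiv (hL : L.IsConn) (hL' : L'.IsConn)
    (e : ∀ σ : F.MaxCone, L.Lift σ.1 ≃ L'.Lift σ.1)
    (he : ∀ σ α, L'.slope (e σ α) = L.slope α) : L.KaneyamaData ≃ L'.KaneyamaData where
  toFun := reindex hL' e he
  invFun := reindex hL (fun σ => (e σ).symm) fun σ α => by rw [← he, Equiv.apply_symm_apply]
  left_inv g := by
    cases g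
    simp [reindex]
  right_inv g := by
    cases g
    simp [reindex]

/-- The matrices over lifts of `σ` in two multi-sections that may be nonzero at `(α, β)` only if
`m(α) - m(β)` is in `σ^∨`. -/
def IsAdaptedBetween (L L' : MultiSection.{u} F r) (σ : PointedCone ℝ V)
    (h : Matrix (L.Lift σ) (L'.Lift σ) ℂ) : Prop :=
  ∀ α β, h α β ≠ 0 → L.slope α - L'.slope β ∈ dualMonoid N σ

lemma IsAdapted.submatrix {σ : PointedCone ℝ V} {K K' : MultiSection.{u} F r}
    {h : Matrix (L.Lift σ) (L.Lift σ) ℂ} (hh : L.IsAdapted σ h)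
    (e : K.Lift σ → L.Lift σ) (he : ∀ α, L.slope (e α) = K.slope α)
    (e' : K'.Lift σ → L.Lift σ) (he' : ∀ α, L.slope (e' α) = K'.slope α) :
    IsAdaptedBetween K K' σ (h.submatrix e e') := by
  intro α β hne
  rw [← he, ← he']
  exact hh _ _ hne

lemma KaneyamaData.reindex_equiv (hL' : L'.IsConn)
    (e : ∀ σ : F.MaxCone, L.Lift σ.1 ≃ L'.Lift σ.1)
    (he : ∀ σ α, L'.slope (e σ α) = L.slope α) {g g' : L.KaneyamaData}
    (h : KaneyamaData.setoid L g g') :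
    KaneyamaData.setoid L' (g.reindex hL' e he) (g'.reindex hL' e he) := by
  obtain ⟨h, h1, h2⟩ := h
  refine ⟨fun σ => ⟨(h σ).val.submatrix (e σ).symm (e σ).symm,
    (h σ).inv.submatrix (e σ).symm (e σ).symm, ?_, ?_⟩, fun σ => ?_, fun σ₁ σ₂ => ?_⟩
  · rw [Matrix.submatrix_mul_equiv, Units.val_inv, Matrix.submatrix_one_equiv]
  · rw [Matrix.submatrix_mul_equiv, Units.inv_val, Matrix.submatrix_one_equiv]
  · exact IsAdapted.submatrix (h1 σ) (e σ).symm
      (fun α => by rw [← he, Equiv.apply_symm_apply]) (e σ).symm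
      (fun α => by rw [← he, Equiv.apply_symm_apply])
  · simp only [reindex]
    rw [Matrix.submatrix_mul_equiv, h2, Matrix.submatrix_mul_equiv]

/-- The matrix of regular functions `h_{αβ} z^{m(α) - m(β)}` on `U(σ)`. -/
noncomputable def homogenize (σ : PointedCone ℝ V) (h : Matrix (L.Lift σ) (L'.Lift σ) ℂ) :
    Matrix (L.Lift σ) (L'.Lift σ) (CoordRing N σ) :=
  Matrix.of fun α β => monom σ (L.slope α - L'.slope β) (h α β)

lemma homogenize_apply {σ : PointedCone ℝ V} (h : Matrix (L.Lift σ) (L'.Lift σ) ℂ)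
    (x : AffineChart N σ) (α β) :
    (homogenize σ h).map x α β = h α β * charVal x (L.slope α - L'.slope β) := by
  simp [homogenize, apply_monom]

/-- Products of matrices supported where the slope differences are in `ρ^∨` are compatible with
the insertion of the characters `z^{m(α) - m(β)}`. -/
lemma mul_of_charVal {ρ : PointedCone ℝ V} {A B C : Type*} [Fintype B]
    (a : A → dualLattice N) (b : B → dualLattice N) (c : C → dualLattice N)
    {P : Matrix A B ℂ} {Q : Matrix B C ℂ}
    (hP : ∀ i j, P i j ≠ 0 → a i - b j ∈ dualMonoid N ρ)
    (hQ : ∀ i j, Q i j ≠ 0 → b i - c j ∈ dualMonoid N ρ) (z : AffineChart N ρ) :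
    (Matrix.of fun i j => P i j * charVal z (a i - b j)) *
      (Matrix.of fun i j => Q i j * charVal z (b i - c j)) =
      Matrix.of fun i j => (P * Q) i j * charVal z (a i - c j) := by
  ext i k
  simp only [Matrix.mul_apply, Matrix.of_apply, Finset.sum_mul]
  refine Finset.sum_congr rfl fun j _ => ?_
  by_cases h : P i j = 0
  · simp [h]
  by_cases h' : Q j k = 0
  · simp [h']
  have e := charVal_add z (hP _ _ h) (hQ _ _ h')
  rw [sub_add_sub_cancel] at e
  rw [e]
  ring

lemma homogenize_incl {ρ σ : PointedCone ℝ V} {h : Matrix (L.Lift σ) (L'.Lift σ) ℂ}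
    (hh : IsAdaptedBetween L L' σ h) (hρ : ρ ≤ σ) (z : AffineChart N ρ) :
    (homogenize σ h).map (chartIncl hρ z) =
      Matrix.of fun α β => h α β * charVal z (L.slope α - L'.slope β) := by
  ext α β
  rw [homogenize_apply, Matrix.of_apply]
  by_cases h0 : h α β = 0
  · simp [h0]
  · rw [charVal_incl _ _ (hh _ _ h0)]

lemma homogenize_mul_eq_one {σ : PointedCone ℝ V} {h : Matrix (L.Lift σ) (L'.Lift σ) ℂ}
    {k : Matrix (L'.Lift σ) (L.Lift σ) ℂ} (hh : IsAdaptedBetween L L' σ h)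
    (hk : IsAdaptedBetween L' L σ k) (hkh : h * k = 1) (x : AffineChart N σ) :
    (homogenize σ h).map x * (homogenize σ k).map x = 1 := by
  have e : ∀ {L L' : MultiSection.{u} F r} (h : Matrix (L.Lift σ) (L'.Lift σ) ℂ),
      (homogenize σ h).map x =
        Matrix.of fun α β => h α β * charVal x (L.slope α - L'.slope β) := fun h => by
    ext α β
    rw [homogenize_apply, Matrix.of_apply]
  rw [e, e, mul_of_charVal L.slope L'.slope L.slope hh hk, hkh]
  ext α β
  by_cases hαβ : α = β
  · subst hαβ
    simp [charVal_zero]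
  · simp [hαβ]

lemma KaneyamaData.map_transition (g : L.KaneyamaData) {σ₁ σ₂ : F.MaxCone}
    (z : AffineChart N (σ₁.1 ⊓ σ₂.1)) : (g.transition σ₁ σ₂).map z =
      Matrix.of fun α β => g.g σ₁ σ₂ α β * charVal z (L.slope α - L.slope β) := by
  ext α β
  exact g.transition_apply z α β

lemma transition_mul_homogenize {g : L.KaneyamaData} {g' : L'.KaneyamaData} {σ₁ σ₂ : F.MaxCone}
    {h₁ : Matrix (L.Lift σ₁.1) (L'.Lift σ₁.1) ℂ} {h₂ : Matrix (L.Lift σ₂.1) (L'.Lift σ₂.1) ℂ}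
    (hh₁ : IsAdaptedBetween L L' σ₁.1 h₁) (hh₂ : IsAdaptedBetween L L' σ₂.1 h₂)
    (hg : g.g σ₁ σ₂ * h₂ = h₁ * g'.g σ₁ σ₂) (z : AffineChart N (σ₁.1 ⊓ σ₂.1)) :
    (g.transition σ₁ σ₂).map z * (homogenize σ₂.1 h₂).map (chartIncl inf_le_right z) =
      (homogenize σ₁.1 h₁).map (chartIncl inf_le_left z) * (g'.transition σ₁ σ₂).map z := by
  rw [homogenize_incl hh₁, homogenize_incl hh₂, g.map_transition, g'.map_transition,
    mul_of_charVal L.slope L.slope L'.slope (fun _ _ h => (g.g_supp _ _ _ _ h).2)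
      (fun _ _ h => dualMonoid_anti inf_le_right (hh₂ _ _ h)),
    mul_of_charVal L.slope L'.slope L'.slope
      (fun _ _ h => dualMonoid_anti inf_le_left (hh₁ _ _ h))
      (fun _ _ h => (g'.g_supp _ _ _ _ h).2), hg]

section Intertwining

variable {g : L.KaneyamaData} {g' : L'.KaneyamaData}
  {h : ∀ σ : F.MaxCone, Matrix (L.Lift σ.1) (L'.Lift σ.1) ℂ}
  (hh : ∀ σ : F.MaxCone, IsAdaptedBetween L L' σ.1 (h σ))
  (hg : ∀ σ₁ σ₂, g.g σ₁ σ₂ * h σ₂ = h σ₁ * g'.g σ₁ σ₂)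

/-- The map of fibres given by adapted matrices that intertwine the Kaneyama data. -/
noncomputable def fiberMap (p : F.Variety) : g.fiber p →ₗ[ℂ] g'.fiber p :=
  LinearMap.codRestrict (g'.fiber p)
    (LinearMap.pi fun a => (Matrix.vecMulLinear ((homogenize a.1.1 (h a.1)).map a.2.1)).comp
      (g.coord a.1 a.2.1 p a.2.2)) fun v σ₁ σ₂ z h₁ h₂ => by
    have key := transition_mul_homogenize (hh σ₁) (hh σ₂) (hg σ₁ σ₂) z
    change Matrix.vecMul (g.coord σ₂ _ p h₂ v)
        ((homogenize σ₂.1 (h σ₂)).map (chartIncl inf_le_right z)) =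
      Matrix.vecMul (Matrix.vecMul (g.coord σ₁ _ p h₁ v)
        ((homogenize σ₁.1 (h σ₁)).map (chartIncl inf_le_left z))) ((g'.transition σ₁ σ₂).map z)
    rw [g.coord_transition z h₁ h₂, Matrix.vecMul_vecMul, Matrix.vecMul_vecMul]
    exact congrArg (Matrix.vecMul (g.coord σ₁ _ p h₁ v)) key

lemma coord_fiberMap (σ : F.MaxCone) (x : AffineChart N σ.1) (p : F.Variety) (hp : σ.pt x = p)
    (v : g.fiber p) : g'.coord σ x p hp (fiberMap hh hg p v) =
      Matrix.vecMul (g.coord σ x p hp v) ((homogenize σ.1 (h σ)).map x) := rfl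

lemma fiberMap_fiberMap {k : ∀ σ : F.MaxCone, Matrix (L'.Lift σ.1) (L.Lift σ.1) ℂ}
    (hk : ∀ σ : F.MaxCone, IsAdaptedBetween L' L σ.1 (k σ))
    (hg' : ∀ σ₁ σ₂, g'.g σ₁ σ₂ * k σ₂ = k σ₁ * g.g σ₁ σ₂) (hhk : ∀ σ, h σ * k σ = 1)
    (p : F.Variety) (v : g.fiber p) : fiberMap hk hg' p (fiberMap hh hg p v) = v := by
  apply g.fiber_ext
  intro σ x hx
  rw [coord_fiberMap, coord_fiberMap, Matrix.vecMul_vecMul,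
    homogenize_mul_eq_one (hh σ) (hk σ) (hhk σ), Matrix.vecMul_one]

lemma fiberMap_act (t : Torus N) (p q : F.Variety) (hpq : t • p = q) (v : g.fiber p) :
    fiberMap hh hg q (g.act t p q hpq v) = g'.act t p q hpq (fiberMap hh hg p v) := by
  apply g'.fiber_ext
  intro σ x hx
  obtain ⟨y, rfl⟩ : ∃ y, x = t • y := ⟨t⁻¹ • x, by rw [smul_inv_smul]⟩
  have hy : σ.pt y = p := by
    have : t • σ.pt y = t • p := by rw [CompleteFan.MaxCone.smul_pt, hx, hpq]
    exact smul_left_cancel _ this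
  funext β
  rw [g'.coord_act t hpq _ σ y hy hx, coord_fiberMap, coord_fiberMap]
  simp only [Matrix.vecMul, dotProduct, Finset.mul_sum]
  refine Finset.sum_congr rfl fun α _ => ?_
  have e : t.pow (L.slope α) = t.pow (L.slope α - L'.slope β) * t.pow (L'.slope β) := by
    rw [← Torus.pow_add, sub_add_cancel]
  have hne := t.pow_ne_zero (L.slope α - L'.slope β)
  rw [g.coord_act t hpq _ σ y hy hx, homogenize_apply, homogenize_apply, charVal_smul, e]
  field_simp

include hh hg in
/-- Kaneyama data that are intertwined by invertible adapted matrices define isomorphic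
bundles. -/
lemma isomorphic_of_intertwining {k : ∀ σ : F.MaxCone, Matrix (L'.Lift σ.1) (L.Lift σ.1) ℂ}
    (hk : ∀ σ : F.MaxCone, IsAdaptedBetween L' L σ.1 (k σ))
    (hhk : ∀ σ, h σ * k σ = 1) (hkh : ∀ σ, k σ * h σ = 1) :
    g.bundle.Isomorphic g'.bundle := by
  have hg' : ∀ σ₁ σ₂, g'.g σ₁ σ₂ * k σ₂ = k σ₁ * g.g σ₁ σ₂ := by
    intro σ₁ σ₂
    have := congrArg (fun M => k σ₁ * M * k σ₂) (hg σ₁ σ₂)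
    simp only [Matrix.mul_assoc, hhk, Matrix.mul_one] at this
    rw [this, ← Matrix.mul_assoc, hkh, Matrix.one_mul]
  let Φ : ∀ p, g.fiber p ≃ₗ[ℂ] g'.fiber p := fun p =>
    LinearEquiv.ofLinearMap (fiberMap hh hg p) (fiberMap hk hg' p)
      (LinearMap.ext (fiberMap_fiberMap hk hg' hh hg hkh p))
      (LinearMap.ext (fiberMap_fiberMap hh hg hk hg' hhk p))
  exact ⟨Φ, fun σ => ⟨homogenize σ.1 (h σ), fun x v => coord_fiberMap hh hg σ x _ rfl v⟩,
    fun σ => ⟨homogenize σ.1 (k σ), fun x v => coord_fiberMap hk hg' σ x _ rfl v⟩,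
    fiberMap_act hh hg⟩

end Intertwining

/-- Slope-preserving bijections of the lifts induce a bijection of classes of Kaneyama data that
preserves the bundle. -/
lemma SameSlopes.exists_equiv (hs : L.SameSlopes L') (hL : L.IsConn) (hL' : L'.IsConn) :
    ∃ f : L.KaneyamaClasses ≃ L'.KaneyamaClasses,
      ∀ (g : L.KaneyamaData) (g' : L'.KaneyamaData), f g.cls = g'.cls →
        g.bundle.Isomorphic g'.bundle := by
  choose e he using hs
  have he' : ∀ σ α, L.slope ((e σ).symm α) = L'.slope α := fun σ α => by
    rw [← he, Equiv.apply_symm_apply]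
  refine ⟨Quotient.congr (KaneyamaData.reindexEquiv hL hL' e he) fun g g' =>
    ⟨fun h => KaneyamaData.reindex_equiv hL' e he h, fun h => ?_⟩, fun g g' hgg' => ?_⟩
  · have := KaneyamaData.reindex_equiv hL (fun σ => (e σ).symm) he' h
    have hid : ∀ g, KaneyamaData.reindex hL (fun σ => (e σ).symm) he'
        (KaneyamaData.reindexEquiv hL hL' e he g) = g :=
      (KaneyamaData.reindexEquiv hL hL' e he).left_inv
    rwa [hid, hid] at this
  · obtain ⟨h, h1, h2⟩ : KaneyamaData.setoid L' (g.reindex hL' e he) g' := Quotient.exact hgg'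
    refine isomorphic_of_intertwining (h := fun σ => ((h σ)⁻¹).val.submatrix (e σ) id)
      (k := fun σ => (h σ).val.submatrix id (e σ)) ?_ ?_ ?_ ?_ ?_
    · exact fun σ => IsAdapted.submatrix (IsAdapted.inv _ (h1 σ)) _ (he σ) _ fun _ => rfl
    · intro σ₁ σ₂
      have e₁ := congrArg (fun M => (h σ₁)⁻¹.val * M * (h σ₂)⁻¹.val) (h2 σ₁ σ₂)
      simp only [← Matrix.mul_assoc, Units.inv_mul, Matrix.one_mul] at e₁
      rw [Matrix.mul_assoc _ (h σ₂).val, Units.mul_inv, Matrix.mul_one] at e₁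
      have e₂ := congrArg (fun M => M.submatrix (e σ₁) (_root_.id : L'.Lift σ₂.1 → _)) e₁
      have e₃ : ((g.reindex hL' e he).g σ₁ σ₂).submatrix (e σ₁) (e σ₂) = g.g σ₁ σ₂ := by
        ext α β
        simp [KaneyamaData.reindex]
      rw [← Matrix.submatrix_mul_equiv _ _ (e σ₁) (e σ₂) id, e₃] at e₂
      exact e₂
    · exact fun σ => IsAdapted.submatrix (h1 σ) _ (fun _ => rfl) _ (he σ)
    · intro σ
      rw [← Matrix.submatrix_mul _ _ (e σ) id (e σ) Function.bijective_id, Units.inv_mul,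
        Matrix.submatrix_one_equiv]
    · intro σ
      rw [Matrix.submatrix_mul_equiv, Units.mul_inv, Matrix.submatrix_id_id]

end MultiSection

/-! ### The torus representation at a fixed point -/

/-- The determinant of an invertible linear map between coordinate spaces has a nonzero term, which
matches the two index sets along nonzero entries. -/
lemma exists_equiv_entry_ne_zero {ι ι' K : Type*} [Fintype ι] [Fintype ι'] [DecidableEq ι]
    [Field K] (T : (ι → K) ≃ₗ[K] (ι' → K)) :
    ∃ e : ι ≃ ι', ∀ i, T (Pi.single i 1) (e i) ≠ 0 := by
  have hcard : Fintype.card ι = Fintype.card ι' := by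
    simpa using T.finrank_eq
  let e₀ : ι ≃ ι' := Fintype.equivOfCardEq hcard
  let S : (ι → K) ≃ₗ[K] (ι → K) := T.trans (LinearEquiv.funCongrLeft K K e₀)
  have hdet : (LinearMap.toMatrix' S.toLinearMap).det ≠ 0 := by
    rw [LinearMap.det_toMatrix']
    exact (LinearEquiv.isUnit_det' S).ne_zero
  rw [Matrix.det_apply] at hdet
  obtain ⟨τ, -, hτ⟩ := Finset.exists_ne_zero_of_sum_ne_zero hdet
  refine ⟨τ.trans e₀, fun i hi => hτ ?_⟩
  rw [Finset.prod_eq_zero (Finset.mem_univ i), smul_zero]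
  rw [LinearMap.toMatrix'_apply]
  exact hi

section FixedPoint

variable {V : Type v} [NormedAddCommGroup V] [NormedSpace ℝ V] {N : Submodule ℤ V}

/-- The torus separates characters: evaluate at the exponentials of vectors. -/
lemma exists_pow_ne {m m' : dualLattice N} (h : m ≠ m') : ∃ t : Torus N, t.pow m ≠ t.pow m' := by
  obtain ⟨x, hx⟩ : ∃ x, m.1 x ≠ m'.1 x := by
    by_contra! hall
    exact h (Subtype.ext (LinearMap.ext hall))
  let t : Multiplicative (dualLattice N) →* ℂˣ :=
    { toFun := fun a => Units.mk0 (Real.exp (a.toAdd.1 x) : ℂ)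
        (by exact_mod_cast (Real.exp_pos _).ne')
      map_one' := by
        ext
        simp
      map_mul' := fun a b => by
        ext
        simp [Real.exp_add] }
  refine ⟨t, fun he => hx (Real.exp_injective ?_)⟩
  have he' : (Real.exp (m.1 x) : ℂ) = Real.exp (m'.1 x) := he
  exact_mod_cast he'

variable [FiniteDimensional ℝ V] {F : CompleteFan N}

lemma CompleteFan.MaxCone.eq_zero_of_add (σ : F.MaxCone) {m m' : dualLattice N}
    (hm : m ∈ dualMonoid N σ.1) (hm' : m' ∈ dualMonoid N σ.1) (h : m + m' = 0) : m = 0 := by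
  refine σ.ext_functional fun x hx => ?_
  have h1 := hm x hx
  have h2 := hm' x hx
  have h3 : m.1 x + m'.1 x = 0 := by
    have := congrArg (fun u : dualLattice N => u.1 x) h
    simpa using this
  simp only [ZeroMemClass.coe_zero, LinearMap.zero_apply]
  linarith

/-- The torus-fixed point of the chart of a full-dimensional cone, where all nontrivial monomials
vanish. -/
noncomputable def CompleteFan.MaxCone.fixedPoint (σ : F.MaxCone) : AffineChart N σ.1 :=
  open Classical in AddMonoidAlgebra.lift ℂ ℂ (dualMonoid N σ.1)
    { toFun := fun a => if a.toAdd.1 = 0 then 1 else 0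
      map_one' := by simp
      map_mul' := fun a b => by
        by_cases ha : a.toAdd.1 = 0
        · rw [toAdd_mul, AddSubmonoid.coe_add, ha, zero_add, if_pos rfl, one_mul]
        · rw [if_neg ha, zero_mul, if_neg]
          exact fun h => ha (σ.eq_zero_of_add a.toAdd.2 b.toAdd.2 h) }

lemma CompleteFan.MaxCone.smul_fixedPoint (σ : F.MaxCone) (t : Torus N) :
    t • σ.fixedPoint = σ.fixedPoint := by
  apply chart_ext'
  intro m hm
  rw [charVal_smul]
  by_cases h : m = 0
  · subst h
    simp [Torus.pow_zero]
  · have : charVal σ.fixedPoint m = 0 := by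
      unfold charVal
      rw [monom_of_mem hm, CompleteFan.MaxCone.fixedPoint, AddMonoidAlgebra.lift_single]
      simp [h]
    rw [this, mul_zero]

namespace MultiSection

variable {r : ℕ} {L L' : MultiSection.{u} F r}

omit [FiniteDimensional ℝ V] in
lemma KaneyamaData.coord_act_of_fixed (g : L.KaneyamaData) (σ : F.MaxCone)
    {x : AffineChart N σ.1} {p : F.Variety} (hx : σ.pt x = p) {t : Torus N} (ht : t • x = x)
    (h : t • p = p) (v : g.fiber p) (α : L.Lift σ.1) :
    g.coord σ x p hx (g.act t p p h v) α = t.pow (L.slope α) * g.coord σ x p hx v α := by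
  have := g.coord_act t h v σ x hx (by rw [ht, hx]) α
  simpa only [ht] using this

/-- At the fixed point of `U(σ)` the torus acts on the fibre through the slopes over `σ`, so an
isomorphism of toric bundles matches the slopes. -/
lemma sameSlopes_of_isomorphic {g : L.KaneyamaData} {g' : L'.KaneyamaData}
    (h : g.bundle.Isomorphic g'.bundle) : L.SameSlopes L' := by
  intro σ
  obtain ⟨Φ, -, -, hΦ⟩ := h
  let p : F.Variety := σ.pt σ.fixedPoint
  let E : g.fiber p ≃ₗ[ℂ] (L.Lift σ.1 → ℂ) :=
    LinearEquiv.ofBijective (g.coord σ σ.fixedPoint p rfl) (g.coord_bijective σ _ p rfl)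
  let E' : g'.fiber p ≃ₗ[ℂ] (L'.Lift σ.1 → ℂ) :=
    LinearEquiv.ofBijective (g'.coord σ σ.fixedPoint p rfl) (g'.coord_bijective σ _ p rfl)
  let Φp : g.fiber p ≃ₗ[ℂ] g'.fiber p := Φ p
  obtain ⟨e, he⟩ := exists_equiv_entry_ne_zero ((E.symm.trans Φp).trans E')
  refine ⟨e, fun α => ?_⟩
  by_contra hne
  obtain ⟨t, ht⟩ := exists_pow_ne hne
  have hp : t • p = p := by
    change t • σ.pt _ = σ.pt _
    rw [CompleteFan.MaxCone.smul_pt, σ.smul_fixedPoint]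
  let v : g.fiber p := E.symm (Pi.single α 1)
  have hv : g.act t p p hp v = t.pow (L.slope α) • v := by
    apply E.injective
    funext β
    have h1 : E v = Pi.single α 1 := E.apply_symm_apply _
    have h2 : E (g.act t p p hp v) β = t.pow (L.slope β) * E v β :=
      g.coord_act_of_fixed σ rfl (σ.smul_fixedPoint t) hp v β
    rw [h2, map_smul, h1, Pi.smul_apply, smul_eq_mul]
    by_cases hβ : β = α
    · subst hβ
      rfl
    · simp [hβ]
  have h1 : Φp (g.act t p p hp v) = g'.act t p p hp (Φp v) := hΦ t p p hp v
  have h2 : E' (g'.act t p p hp (Φp v)) (e α) = t.pow (L'.slope (e α)) * E' (Φp v) (e α) :=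
    g'.coord_act_of_fixed σ rfl (σ.smul_fixedPoint t) hp (Φp v) (e α)
  rw [← h1, hv, map_smul, map_smul, Pi.smul_apply, smul_eq_mul] at h2
  exact ht (mul_right_cancel₀ (he α) h2).symm

end MultiSection

end FixedPoint

/-! ### The quotient by equality of slopes -/

namespace MultiSection

variable {V : Type v} [NormedAddCommGroup V] [NormedSpace ℝ V] {N : Submodule ℤ V}
  {F : CompleteFan N} {r : ℕ}

/-- Two points are identified when they lie over the same point of the base and `φ` has the same
slope near both. -/
noncomputable def slopeSetoid (L : MultiSection.{u} F r) : Setoid L.Dom := Setoid.ker fun x => (L.π x, L.germ x)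

/-- The quotient of the domain by equality of slopes, with the quotient topology. -/
def Collapse (L : MultiSection.{u} F r) : Type u := Quotient L.slopeSetoid

instance (L : MultiSection.{u} F r) : TopologicalSpace L.Collapse :=
  inferInstanceAs (TopologicalSpace (Quotient L.slopeSetoid))

namespace Collapse

variable {L : MultiSection.{u} F r}

/-- The projection to the quotient. -/
noncomputable def mk (x : L.Dom) : L.Collapse := Quotient.mk L.slopeSetoid x

lemma mk_surjective : Function.Surjective (mk : L.Dom → L.Collapse) := Quotient.mk_surjective

lemma continuous_mk : Continuous (mk : L.Dom → L.Collapse) := continuous_quot_mk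

lemma isQuotientMap_mk : Topology.IsQuotientMap (mk : L.Dom → L.Collapse) := isQuotientMap_quot_mk

lemma mk_eq_iff {x y : L.Dom} : (mk x : L.Collapse) = mk y ↔ L.π x = L.π y ∧ L.germ x = L.germ y :=
  Quotient.eq (r := L.slopeSetoid).trans Prod.ext_iff

/-- The projection of the quotient to the base. -/
noncomputable def proj : L.Collapse → V := Quotient.lift L.π fun _ _ h => (Prod.ext_iff.1 h).1

@[simp] lemma proj_mk (x : L.Dom) : proj (mk x) = L.π x := rfl

lemma continuous_proj : Continuous (proj : L.Collapse → V) := continuous_π.quotient_lift _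

/-- The slope function of a class. -/
noncomputable def slopeGerm : L.Collapse → V → ℝ :=
  Quotient.lift L.germ fun _ _ h => (Prod.ext_iff.1 h).2

/-- The quotient cone system: the images of the cones, with the restrictions of the elements of
`M`. -/
noncomputable def system (L : MultiSection.{u} F r) : ConeSystem L.Collapse where
  cones := {t | ∃ s ∈ L.sys.cones, t = mk '' s}
  lat t :=
    { carrier := {f | ∃ m : dualLattice N, ∀ x : t, f x = m.1 (proj x.1)}
      zero_mem' := ⟨0, fun x => by simp⟩
      add_mem' := by
        rintro f g ⟨m, hm⟩ ⟨m', hm'⟩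
        exact ⟨m + m', fun x => by simp [hm, hm']⟩
      neg_mem' := by
        rintro f ⟨m, hm⟩
        exact ⟨-m, fun x => by simp [hm]⟩ }

lemma image_mem {s : Set L.Dom} (hs : s ∈ L.sys.cones) : mk '' s ∈ (system L).cones := ⟨s, hs, rfl⟩

lemma proj_image (s : Set L.Dom) : proj '' (mk '' s : Set L.Collapse) = L.π '' s := by
  rw [Set.image_image]
  rfl

/-- A cone of the domain is homeomorphic to its image in the quotient, since both are homeomorphic
to their common image in the base. -/
noncomputable def coneHomeo {s : Set L.Dom} (hs : s ∈ L.sys.cones) :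
    s ≃ₜ (mk '' s : Set L.Collapse) :=
  (Topology.IsEmbedding.of_comp (continuous_mk.comp continuous_subtype_val) continuous_proj
    (L.isCovering.homeo s hs)).toHomeomorph.trans
    (Homeomorph.setCongr (by ext; simp))

lemma coneHomeo_apply {s : Set L.Dom} (hs : s ∈ L.sys.cones) (x : s) :
    (coneHomeo hs x : L.Collapse) = mk x.1 := rfl

lemma mk_coneHomeo_symm {s : Set L.Dom} (hs : s ∈ L.sys.cones) (y : (mk '' s : Set L.Collapse)) :
    mk ((coneHomeo hs).symm y).1 = y.1 := by
  rw [← coneHomeo_apply hs, Homeomorph.apply_symm_apply]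

lemma isEmbedding_proj {s : Set L.Dom} (hs : s ∈ L.sys.cones) :
    Topology.IsEmbedding fun x : (mk '' s : Set L.Collapse) => proj x.1 := by
  have : (fun x : (mk '' s : Set L.Collapse) => proj x.1) =
      (fun x : s => L.π x) ∘ (coneHomeo hs).symm := by
    funext y
    rw [Function.comp_apply, ← proj_mk, mk_coneHomeo_symm]
  rw [this]
  exact (L.isCovering.homeo s hs).comp (coneHomeo hs).symm.isEmbedding

variable [FiniteDimensional ℝ V]

/-- Functions on the image of a cone correspond to functions on the cone. -/
noncomputable def latEquiv {s : Set L.Dom} (hs : s ∈ L.sys.cones) :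
    (system L).lat (mk '' s) ≃+ L.sys.lat s where
  toFun f := ⟨f.1.comp (coneHomeo hs), by
    obtain ⟨m, hm⟩ := f.2
    exact (MultiSection.mem_lat_iff hs).2 ⟨m, fun x => hm _⟩⟩
  invFun f := ⟨f.1.comp (coneHomeo hs).symm, by
    obtain ⟨m, hm⟩ := (MultiSection.mem_lat_iff hs).1 f.2
    exact ⟨m, fun x => (hm _).trans
      (congrArg (fun y => m.1 (proj y)) (mk_coneHomeo_symm hs x))⟩⟩
  left_inv f := by
    ext x
    exact congrArg f.1 ((coneHomeo hs).apply_symm_apply x)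
  right_inv f := by
    ext x
    exact congrArg f.1 ((coneHomeo hs).symm_apply_apply x)
  map_add' f g := rfl

lemma latEquiv_apply {s : Set L.Dom} (hs : s ∈ L.sys.cones) (f : (system L).lat (mk '' s)) (x : s) :
    (latEquiv hs f).1 x = f.1 ⟨mk x.1, x.1, x.2, rfl⟩ := rfl

lemma image_relInt {s : Set L.Dom} (hs : s ∈ L.sys.cones) {x : L.Dom} (hx : x ∈ s) :
    mk x ∈ (system L).relInt (mk '' s) ↔ x ∈ L.sys.relInt s := by
  constructor
  · intro h
    refine ⟨hx, fun u hu hu0 hux => ?_⟩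
    have h' := h.2 ((latEquiv hs).symm ⟨u, hu⟩).1 ((latEquiv hs).symm ⟨u, hu⟩).2
      (fun y => hu0 _) (by
        rw [← latEquiv_apply hs _ ⟨x, hx⟩, AddEquiv.apply_symm_apply]
        exact hux)
    have h'' : (latEquiv hs).symm ⟨u, hu⟩ = 0 := Subtype.ext h'
    rw [AddEquiv.map_eq_zero_iff] at h''
    exact congrArg Subtype.val h''
  · intro h
    refine ⟨⟨x, hx, rfl⟩, fun u hu hu0 hux => ?_⟩
    have h' := h.2 (latEquiv hs ⟨u, hu⟩).1 (latEquiv hs ⟨u, hu⟩).2 (fun y => hu0 _) hux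
    have h'' : latEquiv hs ⟨u, hu⟩ = 0 := Subtype.ext h'
    rw [AddEquiv.map_eq_zero_iff] at h''
    exact congrArg Subtype.val h''

lemma image_face {s : Set L.Dom} (hs : s ∈ L.sys.cones) (u : (system L).lat (mk '' s)) :
    ConeSystem.face (mk '' s) u.1 = mk '' ConeSystem.face s (latEquiv hs u).1 := by
  ext y
  constructor
  · rintro ⟨⟨x, hx, rfl⟩, h⟩
    exact ⟨x, ⟨hx, h⟩, rfl⟩
  · rintro ⟨x, ⟨hx, h⟩, rfl⟩
    exact ⟨⟨x, hx, rfl⟩, h⟩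

/-- Equivalent points have carriers with the same image in the base and the same slope, so a point
of one carrier is equivalent to the point of the other over the same base point. -/
lemma image_carrier_subset {x y : L.Dom} (h : (mk x : L.Collapse) = mk y) :
    mk '' L.sys.carrier x ⊆ (mk '' L.sys.carrier y : Set L.Collapse) := by
  obtain ⟨hπ, hg⟩ := mk_eq_iff.1 h
  rintro _ ⟨x', hx', rfl⟩
  obtain ⟨y', hy', he⟩ := exists_mem_carrier (x := y) (y := L.π x')
    (by rw [← hπ]; exact π_mem_minCone hx')
  exact ⟨y', hy', mk_eq_iff.2 ⟨he, (germ_eq_germ hg hx' hy' he.symm).symm⟩⟩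

lemma image_carrier_eq {x y : L.Dom} (h : (mk x : L.Collapse) = mk y) :
    mk '' L.sys.carrier x = (mk '' L.sys.carrier y : Set L.Collapse) :=
  (image_carrier_subset h).antisymm (image_carrier_subset h.symm)

/-- The saturation of a cone is closed because it is a union of cones. -/
lemma isClosed_image {s : Set L.Dom} (hs : s ∈ L.sys.cones) :
    IsClosed (mk '' s : Set L.Collapse) := by
  rw [← isQuotientMap_mk.isClosed_preimage]
  have : mk ⁻¹' (mk '' s : Set L.Collapse) =
      ⋃₀ {t | t ∈ L.sys.cones ∧ t ⊆ mk ⁻¹' (mk '' s : Set L.Collapse)} := by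
    refine Set.Subset.antisymm ?_ (Set.sUnion_subset fun t ht => ht.2)
    rintro y ⟨x, hx, hxy⟩
    refine ⟨L.sys.carrier y, ⟨carrier_mem y, fun z hz => ?_⟩, ConeSystem.mem_carrier y⟩
    exact Set.image_mono (ConeSystem.carrier_subset hs hx)
      (image_carrier_subset hxy.symm ⟨z, hz, rfl⟩)
  rw [this, Set.sUnion_eq_biUnion]
  exact (L.isConeComplex.finite.subset fun _ h => h.1).isClosed_biUnion
    fun t ht => L.isConeComplex.closed t ht.1

lemma isConeComplex : (system L).IsConeComplex where
  finite := by
    refine (L.isConeComplex.finite.image (fun s => mk '' s)).subset ?_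
    rintro _ ⟨s, hs, rfl⟩
    exact ⟨s, hs, rfl⟩
  closed := by
    rintro _ ⟨s, hs, rfl⟩
    exact isClosed_image hs
  fg := by
    rintro _ ⟨s, hs, rfl⟩
    rw [← AddGroup.fg_iff_addSubgroup_fg]
    have : AddGroup.FG (L.sys.lat s) :=
      (AddGroup.fg_iff_addSubgroup_fg _).2 (L.isConeComplex.fg s hs)
    exact AddGroup.fg_of_surjective (f := (latEquiv hs).symm.toAddMonoidHom)
      (latEquiv hs).symm.surjective
  embedding := by
    rintro _ ⟨s, hs, rfl⟩
    let e : (L.sys.lat s → ℝ) ≃ₜ ((system L).lat (mk '' s) → ℝ) :=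
      { toFun := fun f u => f (latEquiv hs u)
        invFun := fun f u => f ((latEquiv hs).symm u)
        left_inv := fun f => by simp
        right_inv := fun f => by simp
        continuous_toFun := continuous_pi fun u => continuous_apply _
        continuous_invFun := continuous_pi fun u => continuous_apply _ }
    have h := (e.isEmbedding.comp (L.isConeComplex.embedding s hs)).comp
      (coneHomeo hs).symm.isEmbedding
    convert h using 1
    funext y u
    exact congrArg u.1 ((coneHomeo hs).apply_symm_apply y).symm
  cone := by
    classical
    rintro _ ⟨s, hs, rfl⟩
    obtain ⟨S, hS⟩ := L.isConeComplex.cone s hs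
    let p : (L.sys.lat s →+ ℤ) ≃ ((system L).lat (mk '' s) →+ ℤ) :=
      { toFun := fun f => f.comp (latEquiv hs).toAddMonoidHom
        invFun := fun f => f.comp (latEquiv hs).symm.toAddMonoidHom
        left_inv := fun f => by ext; simp
        right_inv := fun f => by ext; simp }
    refine ⟨S.map p.toEmbedding, Set.ext fun f => ?_⟩
    have key := Set.ext_iff.1 hS fun u => f ((latEquiv hs).symm u)
    refine Iff.trans ⟨?_, ?_⟩ (key.trans ⟨?_, ?_⟩)
    · rintro ⟨y, rfl⟩
      exact ⟨(coneHomeo hs).symm y, rfl⟩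
    · rintro ⟨x, hx⟩
      refine ⟨coneHomeo hs x, funext fun u => ?_⟩
      have := congrFun hx (latEquiv hs u)
      dsimp only at this
      rwa [AddEquiv.symm_apply_apply] at this
    · rintro ⟨c, hc, hf⟩
      refine ⟨fun g => c (p.symm g), fun g => hc _, fun u => ?_⟩
      have := hf (latEquiv hs u)
      dsimp only at this
      rw [AddEquiv.symm_apply_apply] at this
      rw [this, Finset.sum_map]
      refine Finset.sum_congr rfl fun g _ => ?_
      change _ = c (p.symm (p g)) * (g (latEquiv hs u) : ℝ)
      rw [Equiv.symm_apply_apply]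
    · rintro ⟨c, hc, hf⟩
      refine ⟨fun g => c (p g), fun g => hc _, fun u => ?_⟩
      dsimp only
      rw [hf, Finset.sum_map]
      refine Finset.sum_congr rfl fun g _ => ?_
      change c (p g) * (g (latEquiv hs ((latEquiv hs).symm u)) : ℝ) = _
      rw [AddEquiv.apply_symm_apply]
  face_mem := by
    rintro _ ⟨s, hs, rfl⟩ u hu hu0
    rw [image_face hs ⟨u, hu⟩]
    exact image_mem (L.isConeComplex.face_mem s hs _ (latEquiv hs ⟨u, hu⟩).2 fun y => hu0 _)
  face_lat := by
    rintro _ ⟨s, hs, rfl⟩ u hu hu0 v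
    constructor
    · rintro ⟨m, hm⟩
      refine ⟨⟨fun x => m.1 (proj x.1), (continuous_dualLattice m).comp
        (continuous_proj.comp continuous_subtype_val)⟩, ⟨m, fun _ => rfl⟩, hm⟩
    · rintro ⟨w, ⟨m, hm⟩, hw⟩
      exact ⟨m, fun x => by rw [hw, hm]⟩
  partition := by
    intro y
    obtain ⟨x, rfl⟩ := mk_surjective y
    refine ⟨mk '' L.sys.carrier x, ⟨image_mem (carrier_mem x),
      (image_relInt (carrier_mem x) (ConeSystem.mem_carrier x)).2
        (L.isConeComplex.mem_relInt_carrier x)⟩, ?_⟩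
    rintro _ ⟨⟨s, hs, rfl⟩, h⟩
    obtain ⟨x', hx', he⟩ := h.1
    rw [← he, image_relInt hs hx', L.isConeComplex.mem_relInt_iff hs] at h
    rw [← h, image_carrier_eq he]

end Collapse
end MultiSection

/-! ### The collapse of a multi-section -/

namespace MultiSection

variable {V : Type v} [NormedAddCommGroup V] [NormedSpace ℝ V] {N : Submodule ℤ V}
  {F : CompleteFan N} {r : ℕ} [FiniteDimensional ℝ V]

namespace Collapse

variable {L : MultiSection.{u} F r}

/-- The weight of a class is the total weight of its members. -/
noncomputable def weight (y : L.Collapse) : ℕ := L.germCount (proj y) (slopeGerm y)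

/-- The piecewise linear function on the quotient. -/
noncomputable def pl (y : L.Collapse) : ℝ := slopeGerm y (proj y)

lemma pl_mk (x : L.Dom) : pl (mk x) = L.φ x := germ_apply (ConeSystem.mem_carrier x)

omit [FiniteDimensional ℝ V] in
lemma mem_weight_fiber {x : L.Dom} {y : L.Collapse} :
    x ∈ {x | L.π x = proj y ∧ L.germ x = slopeGerm y} ↔ mk x = y := by
  obtain ⟨z, rfl⟩ := mk_surjective y
  exact mk_eq_iff.symm

lemma trace_proj (W : Set L.Collapse) (a : V) :
    ConeSystem.trace proj weight W a = ConeSystem.trace L.π L.μ (mk ⁻¹' W) a := by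
  have hunion : (mk ⁻¹' W : Set L.Dom) ∩ L.π ⁻¹' {a} =
      ⋃ y ∈ W ∩ proj ⁻¹' {a}, {x | L.π x = proj y ∧ L.germ x = slopeGerm y} := by
    ext x
    simp only [Set.mem_iUnion, mem_weight_fiber, exists_prop]
    constructor
    · rintro ⟨h, h'⟩
      exact ⟨mk x, ⟨h, h'⟩, rfl⟩
    · rintro ⟨_, ⟨h, h'⟩, rfl⟩
      exact ⟨h, h'⟩
  symm
  rw [ConeSystem.trace, hunion, finsum_mem_biUnion]
  · rfl
  · rintro y - y' - hne
    exact Set.disjoint_left.2 fun x hx hx' =>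
      hne ((mem_weight_fiber.1 hx).symm.trans (mem_weight_fiber.1 hx'))
  · refine ((L.finite_fiber a).image mk).subset ?_
    rintro y ⟨-, hy⟩
    obtain ⟨x, rfl⟩ := mk_surjective y
    exact ⟨x, hy, rfl⟩
  · exact fun y _ => finite_germ_fiber _ _

lemma isWeight : (system L).IsWeight weight := by
  constructor
  · intro y
    obtain ⟨x, rfl⟩ := mk_surjective y
    exact Nat.pos_of_ne_zero (germCount_ne_zero x)
  · rintro _ ⟨s, hs, rfl⟩ y hy y' hy'
    obtain ⟨x, hx, rfl⟩ := hy.1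
    obtain ⟨x', hx', rfl⟩ := hy'.1
    rw [image_relInt hs hx, L.isConeComplex.mem_relInt_iff hs] at hy
    rw [image_relInt hs hx', L.isConeComplex.mem_relInt_iff hs] at hy'
    have hmin : F.minCone (L.π x) = F.minCone (L.π x') := by
      apply SetLike.coe_injective
      rw [← image_carrier, ← image_carrier, hy, hy']
    obtain ⟨m, hm⟩ := L.exists_slope hs
    have hg : L.germ x = L.germ x' := by rw [germ_eq hs hx hm, germ_eq hs hx' hm, hmin]
    change L.germCount (L.π x) (L.germ x) = L.germCount (L.π x') (L.germ x')
    rw [hg, germCount_congr hmin]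

lemma isCovering : ConeSystem.IsBranchedCovering (system L) weight F.system proj where
  morphism := by
    refine ⟨continuous_proj, ?_⟩
    rintro _ ⟨s, hs, rfl⟩
    have hmaps : Set.MapsTo proj (mk '' s : Set L.Collapse) (L.π '' s) := by
      rintro _ ⟨x, hx, rfl⟩
      exact ⟨x, hx, rfl⟩
    refine ⟨L.π '' s, L.isCovering.image_mem s hs, hmaps, ?_⟩
    rintro u ⟨m, hm⟩
    exact ⟨⟨fun x => m.1 (proj x.1), (continuous_dualLattice m).comp
      (continuous_proj.comp continuous_subtype_val)⟩, ⟨m, fun _ => rfl⟩,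
      fun x => (hm ⟨proj x.1, hmaps x.2⟩).symm⟩
  surjective b := by
    obtain ⟨x, rfl⟩ := L.isCovering.surjective b
    exact ⟨mk x, rfl⟩
  image_mem := by
    rintro _ ⟨s, hs, rfl⟩
    rw [proj_image]
    exact L.isCovering.image_mem s hs
  homeo := by
    rintro _ ⟨s, hs, rfl⟩
    exact isEmbedding_proj hs
  lat_iff := by
    rintro t - v
    constructor
    · rintro ⟨m, hm⟩
      exact ⟨⟨fun y => m.1 y, (continuous_dualLattice m).comp continuous_subtype_val⟩,
        ⟨m, fun _ => rfl⟩, hm⟩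
    · rintro ⟨u, ⟨m, hm⟩, hv⟩
      exact ⟨m, fun x => by rw [hv, hm]⟩
  trace_const U hU hU' y hy a ha b hb := by
    rw [trace_proj, trace_proj]
    refine trace_eq_of_components hU hU' (A := mk ⁻¹' connectedComponentIn (proj ⁻¹' U) y)
      (fun x hx => connectedComponentIn_subset (proj ⁻¹' U) y hx) ?_ ha hb
    intro x hx z hz
    have hxU : mk x ∈ proj ⁻¹' U := connectedComponentIn_subset _ _ hx
    rw [Set.mem_preimage, connectedComponentIn_eq hx]
    refine (isPreconnected_connectedComponentIn.image mk
      continuous_mk.continuousOn).subset_connectedComponentIn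
      ⟨x, mem_connectedComponentIn (F := L.π ⁻¹' U) hxU, rfl⟩ ?_ ⟨z, hz, rfl⟩
    rintro _ ⟨w, hw, rfl⟩
    exact connectedComponentIn_subset (L.π ⁻¹' U) x hw

end Collapse

/-- The multi-section on the quotient by equality of slopes. -/
noncomputable def collapse (L : MultiSection.{u} F r) : MultiSection.{u} F r where
  Dom := L.Collapse
  sys := Collapse.system L
  isConeComplex := Collapse.isConeComplex
  μ := Collapse.weight
  isWeight := Collapse.isWeight
  π := Collapse.proj
  isCovering := Collapse.isCovering
  rank_eq b := by rw [Collapse.trace_proj, Set.preimage_univ, L.rank_eq]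
  φ := Collapse.pl
  piecewiseLinear := by
    rintro _ ⟨s, hs, rfl⟩
    obtain ⟨m, hm⟩ := L.exists_slope hs
    refine ⟨⟨fun x => m.1 (Collapse.proj x.1), (continuous_dualLattice m).comp
      (Collapse.continuous_proj.comp continuous_subtype_val)⟩, ⟨m, fun _ => rfl⟩, ?_⟩
    rintro ⟨_, x, hx, rfl⟩
    exact (Collapse.pl_mk x).trans (hm x hx)

/-- A multi-section with the same counts as `L` maps to the collapse of `L`: a point goes to the
class of the points of `L` with the same image and slope, whose total weight is the count. -/
lemma collapse_leq_of_germCount {L L' : MultiSection.{u} F r}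
    (h : ∀ b G, L.germCount b G = L'.germCount b G) : L.collapse.Leq L' := by
  have hex : ∀ y : L'.Dom, ∃ x : L.Dom, L.π x = L'.π y ∧ L.germ x = L'.germ y := fun y =>
    exists_of_germCount_ne_zero (by rw [h]; exact germCount_ne_zero y)
  have hex' : ∀ x : L.Dom, ∃ y : L'.Dom, L'.π y = L.π x ∧ L'.germ y = L.germ x := fun x =>
    exists_of_germCount_ne_zero (by rw [← h]; exact germCount_ne_zero x)
  choose e heπ heg using hex
  let f : L'.Dom → L.Collapse := fun y => Collapse.mk (e y)
  have hf : ∀ {y : L'.Dom} {x : L.Dom}, f y = Collapse.mk x ↔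
      L'.π y = L.π x ∧ L'.germ y = L.germ x := fun {y x} => by
    rw [← heπ, ← heg]
    exact Collapse.mk_eq_iff
  have hproj : ∀ y, Collapse.proj (f y) = L'.π y := heπ
  -- Each cone of `L'` goes to the class of a cone of `L` with the same image and slope.
  have hcone : ∀ s ∈ L'.sys.cones, ∃ t ∈ L.sys.cones, Set.MapsTo f s (Collapse.mk '' t) := by
    intro s hs
    obtain ⟨σ, hσ, he⟩ := exists_cone_image hs
    obtain ⟨b, hb⟩ := F.exists_minCone_eq hσ
    obtain ⟨y, hy, rfl⟩ := he.superset (hb ▸ F.mem_minCone b)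
    have hcar : L'.sys.carrier y = s := carrier_eq_of_image hs hy (by rw [he, hb])
    refine ⟨L.sys.carrier (e y), carrier_mem _, fun y' hy' => ?_⟩
    rw [← hcar] at hy'
    obtain ⟨x', hx', hx''⟩ := exists_mem_carrier (x := e y) (y := L'.π y')
      (by rw [heπ]; exact π_mem_minCone hy')
    exact ⟨x', hx', (hf.2 ⟨hx''.symm, (germ_eq_germ (heg y) hx' hy' hx'').symm⟩).symm⟩
  have hcont : Continuous f := by
    have hlf : LocallyFinite fun s : L'.sys.cones => (s : Set L'.Dom) := by
      have : Finite L'.sys.cones := L'.isConeComplex.finite.to_subtype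
      exact locallyFinite_of_finite _
    refine hlf.continuous (Set.eq_univ_of_forall fun y => Set.mem_iUnion.2
      ⟨⟨_, carrier_mem y⟩, ConeSystem.mem_carrier y⟩)
      (fun s => L'.isConeComplex.closed s.1 s.2) fun s => ?_
    obtain ⟨t, ht, hmaps⟩ := hcone s.1 s.2
    rw [continuousOn_iff_continuous_domRestrict]
    have h1 : Continuous fun y : s.1 => (⟨f y, hmaps y.2⟩ : (Collapse.mk '' t : Set L.Collapse)) := by
      rw [(Collapse.isEmbedding_proj ht).continuous_iff]
      change Continuous fun y : s.1 => Collapse.proj (f y)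
      simp only [hproj]
      exact continuous_π.comp continuous_subtype_val
    exact continuous_subtype_val.comp h1
  refine ⟨f, fun z => ?_, ⟨hcont, fun s hs => ?_⟩, hproj, fun z => ?_, fun y => ?_⟩
  · obtain ⟨x, rfl⟩ := Collapse.mk_surjective z
    obtain ⟨y, hy⟩ := hex' x
    exact ⟨y, hf.2 hy⟩
  · obtain ⟨t, ht, hmaps⟩ := hcone s hs
    refine ⟨_, Collapse.image_mem ht, hmaps, ?_⟩
    rintro u ⟨m, hm⟩
    refine ⟨⟨fun x => m.1 (L'.π x), (continuous_dualLattice m).comp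
      (continuous_π.comp continuous_subtype_val)⟩,
      (mem_lat_iff hs).2 ⟨m, fun _ => rfl⟩, fun x => ?_⟩
    exact ((hm ⟨f x, hmaps x.2⟩).trans (congrArg m.1 (hproj x))).symm
  · obtain ⟨x, rfl⟩ := Collapse.mk_surjective z
    change _ = L.germCount (L.π x) (L.germ x)
    rw [h]
    refine finsum_mem_congr (Set.ext fun y => ?_) fun _ _ => rfl
    rw [Set.univ_inter]
    exact hf
  · change Collapse.pl (Collapse.mk (e y)) = _
    rw [Collapse.pl_mk, ← germ_apply (ConeSystem.mem_carrier (e y)), heπ, heg,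
      germ_apply (ConeSystem.mem_carrier y)]

/-- Connected multi-sections with the same slopes have the collapse of the first one as a common
lower bound. -/
lemma SameSlopes.combEquiv {L L' : MultiSection.{u} F r} (h : L.SameSlopes L') (hL : L.IsConn)
    (hL' : L'.IsConn) : L.CombEquiv L' :=
  .single ⟨hL, hL', L.collapse, collapse_leq_of_germCount fun _ _ => rfl,
    collapse_leq_of_germCount h.germCount_eq⟩

end MultiSection
end TropToric

theorem theorem4p4 {V : Type v} [NormedAddCommGroup V] [NormedSpace ℝ V] [FiniteDimensional ℝ V]
    (N : Submodule ℤ V) [DiscreteTopology N] [IsZLattice ℝ N]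
    (F : TropToric.CompleteFan N) (r : ℕ) (L₁ L₂ : TropToric.MultiSection.{u} F r)
    (h₁ : L₁.IsConn) (h₂ : L₂.IsConn) :
    (L₁.CombEquiv L₂ →
      ∃ f : L₁.KaneyamaClasses ≃ L₂.KaneyamaClasses,
        ∀ (g₁ : L₁.KaneyamaData) (g₂ : L₂.KaneyamaData), f g₁.cls = g₂.cls →
          g₁.bundle.Isomorphic g₂.bundle) ∧
    (∀ (g₁ : L₁.KaneyamaData) (g₂ : L₂.KaneyamaData),
      g₁.bundle.Isomorphic g₂.bundle → L₁.CombEquiv L₂) :=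
  ⟨fun h => h.sameSlopes.exists_equiv h₁ h₂,
    fun _ _ h => (TropToric.MultiSection.sameSlopes_of_isomorphic h).combEquiv h₁ h₂⟩
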